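/- Let $1\le p<\infty$ and $\alpha>-1$, and let $\mu$ be a positive Borel measure on $[0,1)$. For $s>0$ call $\mu$ an $s$-Carleson measure if there is $C>0$ with $\mu([t,1))\le C(1-t)^s$ for all $0\le t<1$, and a $1$-logarithmic $s$-Carleson measure if there is $C>0$ with $\mu([t,1))\log\frac1{1-t}\le C(1-t)^s$ for all $0\le t<1$. Let $A^p_\alpha$ be the space of functions $f$ analytic in the unit disc $\mathbb D$ with $$\|f\|_{A^p_\alpha}=\Big((\alpha+1)\int_{\mathbb D}|f(z)|^p(1-|z|^2)^\alpha\,dA(z)\Big)^{1/p}<\infty,\qquad dA=\tfrac1\pi\,dx\,dy.$$ For $\beta>0$ and $f(z)=\sum_{k\ge0}a_kz^k$ analytic in $\mathbb D$ put $$\mathcal H_{\mu,\beta}(f)(z)=\sum_{n=0}^\infty\Big(\sum_{k=0}^\infty\mu_{n,k,\beta}\,a_k\Big)z^n,\qquad \mu_{n,k,\beta}=\int_{[0,1)}\frac{\Gamma(n+\beta)}{n!\,\Gamma(\beta)}\,t^{n+k}\,d\mu(t),$$ whenever the entries are finite, the inner series converge and the power series converges in $\mathbb D$. To say that $\mathcal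 H_{\mu,\beta}$ is bounded on $A^p_\alpha$ means that $\mathcal H_{\mu,\beta}(f)$ is well defined and belongs to $A^p_\alpha$ for every $f\in A^p_\alpha$, and that there is a constant $C$ with $\|\mathcal H_{\mu,\beta}(f)\|_{A^p_\alpha}\le C\|f\|_{A^p_\alpha}$ for all $f\in A^p_\alpha$. Assume that $\mu$ is a $\frac{\alpha+2-(p-1)^2}{p}$-Carleson measure if $1\le p\le2$, and a $\frac{\alpha+1}{p}$-Carleson measure if $p\ge2$. Then: (i) if $p>1$, $\mathcal H_{\mu,\alpha+2}$ is bounded on $A^p_\alpha$ if and only if $\mu$ is an $(\alpha+2)$-Carleson measure; (ii) if $p=1$, $\mathcal H_{\mu,\alpha+2}$ is bounded on $A^1_\alpha$ if and only if $\mu$ is a $1$-logarithmic $(\alpha+2)$-Carleson measure. -/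

import Mathlib

open MeasureTheory Set Filter Topology
open scoped ENNReal NNReal

noncomputable section

/-- The (quasi-)norm of the weighted Bergman space `A^p_α` of the unit disc, as an extended
nonnegative number: `((α + 1) ∫_𝔻 |f z| ^ p (1 - |z| ^ 2) ^ α dA(z)) ^ (1 / p)`, where `dA` is the
area measure divided by `π`. -/
def bergmanNorm (p α : ℝ) (f : ℂ → ℂ) : ℝ≥0∞ :=
  (ENNReal.ofReal ((α + 1) / Real.pi) *
    ∫⁻ z in Metric.ball (0 : ℂ) 1,
      ENNReal.ofReal (‖f z‖ ^ p * (1 - ‖z‖ ^ 2) ^ α)) ^ (1 / p)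

/-- The weighted Bergman space `A^p_α`: the functions analytic in the unit disc whose Bergman norm
is finite. (The values of `f` outside the disc play no role.) -/
def bergmanSpace (p α : ℝ) : Set (ℂ → ℂ) :=
  {f | DifferentiableOn ℂ f (Metric.ball 0 1) ∧ bergmanNorm p α f < ∞}

/-- The `k`-th Taylor coefficient of `f` at the origin. -/
def taylorCoeff (f : ℂ → ℂ) (k : ℕ) : ℂ :=
  iteratedDeriv k f 0 / (k.factorial : ℂ)

/-- The entry `μ_{n,k,β} = ∫_{[0,1)} Γ(n + β) / (n! Γ(β)) t ^ (n + k) dμ(t)` of the generalized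
Hankel matrix. A Borel measure on `[0, 1)` is given as a measure on `ℝ` of which only the
restriction to `[0, 1)` is used. -/
def hankelEntry (μ : Measure ℝ) (β : ℝ) (n k : ℕ) : ℝ :=
  ∫ t in Ico (0 : ℝ) 1,
    Real.Gamma (n + β) / (n.factorial * Real.Gamma β) * t ^ (n + k) ∂μ

/-- Partial sums of the series `∑_k μ_{n,k,β} a_k`, where `f z = ∑_k a_k z ^ k`. -/
def hankelPartialSum (μ : Measure ℝ) (β : ℝ) (f : ℂ → ℂ) (n N : ℕ) : ℂ :=
  ∑ k ∈ Finset.range N, (hankelEntry μ β n k : ℂ) * taylorCoeff f k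

/-- The sum of the (possibly only conditionally convergent) series `∑_k μ_{n,k,β} a_k`. -/
def hankelCoeff (μ : Measure ℝ) (β : ℝ) (f : ℂ → ℂ) (n : ℕ) : ℂ :=
  limUnder atTop (hankelPartialSum μ β f n)

/-- The generalized Hilbert operator `H_{μ,β} f z = ∑_n (∑_k μ_{n,k,β} a_k) z ^ n`. -/
def hilbertOp (μ : Measure ℝ) (β : ℝ) (f : ℂ → ℂ) (z : ℂ) : ℂ :=
  ∑' n : ℕ, hankelCoeff μ β f n * z ^ n

/-- `H_{μ,β} f` is well defined: the entries of the matrix are finite, each of the series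
`∑_k μ_{n,k,β} a_k` converges, and the resulting power series converges in the unit disc. -/
def HilbertOpDefined (μ : Measure ℝ) (β : ℝ) (f : ℂ → ℂ) : Prop :=
  (∀ m : ℕ, IntegrableOn (fun t : ℝ => t ^ m) (Ico 0 1) μ) ∧
  (∀ n : ℕ, ∃ l : ℂ, Tendsto (hankelPartialSum μ β f n) atTop (𝓝 l)) ∧
  (∀ z ∈ Metric.ball (0 : ℂ) 1, Summable fun n : ℕ => hankelCoeff μ β f n * z ^ n)

/-- `H_{μ,β}` is a (well defined and) bounded operator from `A^p_α` into itself. -/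
def HilbertOpBoundedOn (μ : Measure ℝ) (β p α : ℝ) : Prop :=
  (∀ f ∈ bergmanSpace p α, HilbertOpDefined μ β f ∧ hilbertOp μ β f ∈ bergmanSpace p α) ∧
  ∃ C : ℝ≥0, ∀ f ∈ bergmanSpace p α,
    bergmanNorm p α (hilbertOp μ β f) ≤ C * bergmanNorm p α f

/-- A measure on `[0, 1)` is an `s`-Carleson measure: `μ [t, 1) ≤ C (1 - t) ^ s`. -/
def IsCarleson (s : ℝ) (μ : Measure ℝ) : Prop :=
  ∃ C : ℝ, 0 < C ∧ ∀ t ∈ Ico (0 : ℝ) 1,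
    μ (Ico t 1) ≤ ENNReal.ofReal (C * (1 - t) ^ s)

/-- A measure on `[0, 1)` is an `a`-logarithmic `s`-Carleson measure:
`μ [t, 1) (log (2π / |I|)) ^ a ≤ C (1 - t) ^ s`, where `|I| = 2π (1 - t)` is the length of the arc
centred at `1` whose Carleson square meets `[0, 1)` in `[t, 1)`. -/
def IsLogCarleson (a s : ℝ) (μ : Measure ℝ) : Prop :=
  ∃ C : ℝ, 0 < C ∧ ∀ t ∈ Ico (0 : ℝ) 1,
    μ (Ico t 1) * ENNReal.ofReal (Real.log (1 / (1 - t)) ^ a) ≤ ENNReal.ofReal (C * (1 - t) ^ s)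

/-- The standing assumption on the measure: `μ` is an `s`-Carleson measure, where
`s = (α + 2) / p` if `0 < p ≤ 1`, `s = (α + 2 - (p - 1) ^ 2) / p` if `1 ≤ p ≤ 2`, and
`s = (α + 1) / p` if `2 ≤ p`. -/
def StandingCarlesonCondition (p α : ℝ) (μ : Measure ℝ) : Prop :=
  (0 < p ∧ p ≤ 1 ∧ IsCarleson ((α + 2) / p) μ) ∨
  (1 ≤ p ∧ p ≤ 2 ∧ IsCarleson ((α + 2 - (p - 1) ^ 2) / p) μ) ∨
  (2 ≤ p ∧ IsCarleson ((α + 1) / p) μ)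

end

/-! Write s = α + 2. Everything rests on the representation H f(z) = ∫ f(t) (1 - t z)^(-s) dμ(t),
obtained by expanding the kernel in its binomial series. The inner series need not converge
absolutely, so the representation requires that the Taylor polynomials of f converge to f in L¹(μ).
When μ is s-Carleson this holds for every f in A^p_α: averaging Cauchy's estimate over thin annuli
gives a_k = o(k^(α+1)). This handles the polynomials on [1 - 1/N, 1) through a Cesàro mean and the
remainders on [0, 1 - 1/N) through an explicit power series.

Sufficiency. The mean value property gives the radial Carleson embedding ∫ |f|^p dμ ≤ C ‖f‖^p
(`TailBound.lintegral_enorm_rpow_le`). For p > 1, Schur's test for the kernel |1 - t z|^(-s), with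
the test functions (1 - t)^(-ε) and (1 - |z|)^(-ε), maps L^p(μ) into L^p of the weighted area
measure. For p = 1, Tonelli and the critical Forelli–Rudin estimate ∫ |1 - t z|^(-s) dA_α ≲ 1 +
log(1/(1 - t)) reduce the claim to the embedding for (1 + log(1/(1 - t))) dμ, which is s-Carleson
exactly because of the logarithmic condition.

Necessity. Apply the operator to f_a(z) = (1 - a z)^(-m) with m > s. On a narrow cone with vertex 1,
cut off at Re z ≤ a, the kernel has real part at least half its modulus for every t, so nothing
cancels and |H f_a(z)| ≳ μ([a,1)) (1 - a)^(-m) (1 - Re z)^(-s). Integrating the p-th power over the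
cone and comparing with ‖f_a‖^p ≲ (1 - a)^(s - mp) yields μ([a,1))^p ∫_0^a (1 - x)^(α + 1 - s p) dx
≲ (1 - a)^s (`HilbertOpBoundedOn.exists_measure_rpow_mul_lintegral_le`). For p = 1 the integral is
log(1/(1 - a)); for p > 1 it is at least of order (1 - a)^(s(1 - p)). Both conditions follow. -/

/-! ### One-variable integrals and tails of measures -/

lemma lintegral_Ioc_rpow_sub_one {a v : ℝ} (ha : 0 < a) (hv : 0 ≤ v) :
    ∫⁻ u in Ioc 0 v, ENNReal.ofReal (u ^ (a - 1)) = ENNReal.ofReal (v ^ a / a) := by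
  have hint : IntervalIntegrable (fun u : ℝ => u ^ (a - 1)) volume 0 v :=
    intervalIntegral.intervalIntegrable_rpow' (by linarith)
  rw [← ofReal_integral_eq_lintegral_ofReal]
  · rw [← intervalIntegral.integral_of_le hv, integral_rpow (Or.inl (by linarith))]
    simp [Real.zero_rpow ha.ne']
  · exact (intervalIntegrable_iff_integrableOn_Ioc_of_le hv).1 hint
  · filter_upwards [ae_restrict_mem measurableSet_Ioc] with u hu
    exact Real.rpow_nonneg hu.1.le _

lemma lintegral_Ioi_rpow_neg_sub_one {c v : ℝ} (hc : 0 < c) (hv : 0 < v) :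
    ∫⁻ u in Ioi v, ENNReal.ofReal (u ^ (-c - 1)) = ENNReal.ofReal (v ^ (-c) / c) := by
  rw [← ofReal_integral_eq_lintegral_ofReal]
  · rw [integral_Ioi_rpow_of_lt (by linarith) hv]
    congr 1
    rw [sub_add_cancel, neg_div_neg_eq]
  · exact integrableOn_Ioi_rpow_of_lt (by linarith) hv
  · filter_upwards [ae_restrict_mem measurableSet_Ioi] with u hu
    exact Real.rpow_nonneg (hv.trans hu).le _

lemma lintegral_Ioc_inv {v w : ℝ} (hv : 0 < v) (hvw : v ≤ w) :
    ∫⁻ u in Ioc v w, ENNReal.ofReal u⁻¹ = ENNReal.ofReal (Real.log (w / v)) := by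
  have h0 : (0 : ℝ) ∉ uIcc v w := by
    rw [uIcc_of_le hvw]
    exact fun h => absurd h.1 (not_le.2 hv)
  have hint : IntervalIntegrable (fun u : ℝ => u⁻¹) volume v w := by
    exact intervalIntegral.intervalIntegrable_inv (fun x hx h => h0 (h ▸ hx)) continuousOn_id
  rw [← ofReal_integral_eq_lintegral_ofReal]
  · rw [← intervalIntegral.integral_of_le hvw, integral_inv h0]
  · exact (intervalIntegrable_iff_integrableOn_Ioc_of_le hvw).1 hint
  · filter_upwards [ae_restrict_mem measurableSet_Ioc] with u hu
    exact inv_nonneg.2 (hv.trans hu.1).le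

lemma lintegral_Ioc_rpow_mul_max_rpow {a b v : ℝ} (ha : 0 < a) (hv : 0 < v) :
    ∫⁻ u in Ioc 0 v, ENNReal.ofReal (u ^ (a - 1) * max u v ^ (-b)) =
      ENNReal.ofReal (v ^ (a - b) / a) := by
  have h1 : ∀ u ∈ Ioc 0 v, ENNReal.ofReal (u ^ (a - 1) * max u v ^ (-b)) =
      ENNReal.ofReal (v ^ (-b)) * ENNReal.ofReal (u ^ (a - 1)) := fun u hu => by
    rw [max_eq_right hu.2, ← ENNReal.ofReal_mul (Real.rpow_nonneg hv.le _), mul_comm]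
  rw [setLIntegral_congr_fun measurableSet_Ioc h1, lintegral_const_mul _ (by fun_prop),
    lintegral_Ioc_rpow_sub_one ha hv.le, ← ENNReal.ofReal_mul (Real.rpow_nonneg hv.le _),
    sub_eq_neg_add, Real.rpow_add hv, mul_div_assoc]

lemma lintegral_Ioi_rpow_mul_max_rpow_le {a b v : ℝ} (ha : 0 < a) (hab : a < b) (hv : 0 < v) :
    ∫⁻ u in Ioi 0, ENNReal.ofReal (u ^ (a - 1) * max u v ^ (-b)) ≤
      ENNReal.ofReal ((1 / a + 1 / (b - a)) * v ^ (a - b)) := by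
  have h2 : ∀ u ∈ Ioi v, ENNReal.ofReal (u ^ (a - 1) * max u v ^ (-b)) =
      ENNReal.ofReal (u ^ (-(b - a) - 1)) := fun u hu => by
    rw [max_eq_left (le_of_lt hu), ← Real.rpow_add (hv.trans hu)]
    ring_nf
  have hba : 0 < b - a := sub_pos.2 hab
  have := Real.rpow_nonneg hv.le (a - b)
  rw [← Ioc_union_Ioi_eq_Ioi hv.le]
  refine (lintegral_union_le _ _ _).trans ?_
  rw [lintegral_Ioc_rpow_mul_max_rpow ha hv, setLIntegral_congr_fun measurableSet_Ioi h2,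
    lintegral_Ioi_rpow_neg_sub_one hba hv, neg_sub, ← ENNReal.ofReal_add (by positivity)
    (by positivity)]
  refine ENNReal.ofReal_le_ofReal (le_of_eq ?_)
  ring

/-- The critical exponent: beyond v the integrand is 1/u. This is the source of the logarithm at p =
1. -/
lemma lintegral_Ioc_rpow_mul_max_rpow_neg_le {a v : ℝ} (ha : 0 < a) (hv : 0 < v) (hv1 : v ≤ 1) :
    ∫⁻ u in Ioc 0 1, ENNReal.ofReal (u ^ (a - 1) * max u v ^ (-a)) ≤
      ENNReal.ofReal (1 / a + Real.log (1 / v)) := by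
  have h2 : ∀ u ∈ Ioc v 1, ENNReal.ofReal (u ^ (a - 1) * max u v ^ (-a)) =
      ENNReal.ofReal u⁻¹ := fun u hu => by
    rw [max_eq_left hu.1.le, ← Real.rpow_add (hv.trans hu.1), ← Real.rpow_neg_one]
    ring_nf
  rw [← Ioc_union_Ioc_eq_Ioc hv.le hv1]
  refine (lintegral_union_le _ _ _).trans ?_
  rw [lintegral_Ioc_rpow_mul_max_rpow ha hv, setLIntegral_congr_fun measurableSet_Ioc h2,
    lintegral_Ioc_inv hv hv1, sub_self, Real.rpow_zero, ENNReal.ofReal_add (by positivity)]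
  exact Real.log_nonneg (by rw [le_div_iff₀ hv]; linarith)

lemma setLIntegral_Ioo_zero_one_comp_one_sub (g : ℝ → ℝ≥0∞) :
    ∫⁻ x in Ioo (0 : ℝ) 1, g (1 - x) = ∫⁻ x in Ioo (0 : ℝ) 1, g x := by
  rw [← lintegral_indicator measurableSet_Ioo, ← lintegral_indicator measurableSet_Ioo,
    ← lintegral_sub_left_eq_self _ (1 : ℝ)]
  congr 1
  ext x
  by_cases hx : x ∈ Ioo (0 : ℝ) 1
  · have h1 : 1 - x ∈ Ioo (0 : ℝ) 1 := ⟨by linarith [hx.2], by linarith [hx.1]⟩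
    simp [indicator_of_mem hx, indicator_of_mem h1]
  · have h1 : 1 - x ∉ Ioo (0 : ℝ) 1 := fun h => hx ⟨by linarith [h.2], by linarith [h.1]⟩
    simp [indicator_of_notMem hx, indicator_of_notMem h1]

/-- The integral of an increasing function against a measure on `[0, 1)` is controlled by the
tails of the measure. -/
lemma lintegral_Ico_le_lintegral_tail {μ : Measure ℝ} (hfin : μ (Ico 0 1) ≠ ∞) {K : ℝ → ℝ≥0∞}
    (hK : Measurable K) (hmono : MonotoneOn K (Ico 0 1)) :
    ∫⁻ t in Ico 0 1, K t ∂μ ≤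
      ∫⁻ x in Ioo 0 1, K x * (ENNReal.ofReal (2 / (1 - x)) * μ (Ico (max (2 * x - 1) 0) 1)) := by
  have : IsFiniteMeasure (μ.restrict (Ico 0 1)) := ⟨by simpa using hfin.lt_top⟩
  -- As K increases, K(t) is at most its average over (t, (1 + t)/2), an interval of length (1 -
  -- t)/2. After the order of integration is exchanged, x meets only those t with t > 2x - 1.
  set S : Set (ℝ × ℝ) := {q | q.1 < q.2 ∧ q.2 < (1 + q.1) / 2}
  have hS : MeasurableSet S := by
    exact (measurableSet_lt measurable_fst measurable_snd).inter
      (measurableSet_lt measurable_snd ((measurable_fst.const_add 1).div_const 2))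
  set F : ℝ → ℝ → ℝ≥0∞ := fun t x =>
    S.indicator (fun q => K q.2 * ENNReal.ofReal (2 / (1 - q.2))) (t, x)
  have hF : Measurable (Function.uncurry F) := by
    apply Measurable.indicator _ hS
    fun_prop
  calc ∫⁻ t in Ico 0 1, K t ∂μ ≤ ∫⁻ t in Ico 0 1, ∫⁻ x in Ioo 0 1, F t x ∂volume ∂μ := by
        refine setLIntegral_mono' measurableSet_Ico fun t ht => ?_
        have h1 : ∫⁻ x in Ioo t ((1 + t) / 2), K t * ENNReal.ofReal (2 / (1 - t)) = K t := by
          rw [lintegral_const, Measure.restrict_apply_univ, Real.volume_Ioo, mul_assoc,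
            ← ENNReal.ofReal_mul (div_nonneg two_pos.le (by linarith [ht.2]))]
          have : 2 / (1 - t) * ((1 + t) / 2 - t) = 1 := by
            have : 1 - t ≠ 0 := by linarith [ht.2]
            field_simp
            ring
          simp [this]
        have hsub : Ioo t ((1 + t) / 2) ⊆ Ioo 0 1 :=
          Ioo_subset_Ioo ht.1 (by linarith [ht.2])
        rw [← h1]
        refine le_trans ?_ (lintegral_mono_set hsub)
        refine setLIntegral_mono' measurableSet_Ioo fun x hx => ?_
        have hx1 := hsub hx
        simp only [F]
        rw [indicator_of_mem (show (t, x) ∈ S from hx)]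
        have h2 : (0 : ℝ) < 1 - x := by linarith [hx1.2]
        refine mul_le_mul' (hmono ht ⟨hx1.1.le, hx1.2⟩ hx.1.le) (ENNReal.ofReal_le_ofReal ?_)
        exact div_le_div_of_nonneg_left two_pos.le h2 (by linarith [hx.1])
    _ = ∫⁻ x in Ioo 0 1, ∫⁻ t in Ico 0 1, F t x ∂μ := lintegral_lintegral_swap hF.aemeasurable
    _ ≤ _ := by
        refine setLIntegral_mono' measurableSet_Ioo fun x hx => ?_
        calc ∫⁻ t in Ico 0 1, F t x ∂μ
            ≤ ∫⁻ t in Ico 0 1, (Ico (max (2 * x - 1) 0) 1).indicator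
              (fun _ => K x * ENNReal.ofReal (2 / (1 - x))) t ∂μ := by
              refine setLIntegral_mono' measurableSet_Ico fun t ht => ?_
              simp only [F]
              by_cases hq : (t, x) ∈ S
              · have hq' : x < (1 + t) / 2 := hq.2
                have : t ∈ Ico (max (2 * x - 1) 0) 1 :=
                  ⟨max_le (by linarith) ht.1, ht.2⟩
                rw [indicator_of_mem hq, indicator_of_mem this]
              · rw [indicator_of_notMem hq]
                exact zero_le
          _ ≤ _ := by
              refine (setLIntegral_le_lintegral _ _).trans ?_
              rw [lintegral_indicator_const measurableSet_Ico, mul_assoc]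

/-! ### Polar coordinates and Forelli–Rudin estimates -/

/-- Measurability is asked only on the ball, since g will come from a function analytic there and
arbitrary outside. -/
lemma lintegral_ball_eq_polar {R : ℝ} {g : ℂ → ℝ≥0∞}
    (hg : Measurable ((Metric.ball 0 R).indicator g)) :
    ∫⁻ z in Metric.ball 0 R, g z =
      ∫⁻ r in Ioo 0 R, ENNReal.ofReal r * ∫⁻ θ in Ioo (-Real.pi) Real.pi, g (circleMap 0 r θ) := by
  set G := (Metric.ball 0 R).indicator g with hG
  have hcm : Measurable fun q : ℝ × ℝ => G (circleMap 0 q.1 q.2) :=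
    hg.comp (by unfold circleMap; fun_prop)
  have hmap : ∀ p : ℝ × ℝ, Complex.polarCoord.symm p = circleMap 0 p.1 p.2 := fun p => by
    rw [Complex.polarCoord_symm_apply, circleMap, Complex.exp_mul_I, zero_add]
    push_cast
    rfl
  rw [← lintegral_indicator Metric.isOpen_ball.measurableSet, ← hG,
    ← Complex.lintegral_comp_polarCoord_symm, polarCoord_target,
    Measure.volume_eq_prod, ← Measure.prod_restrict]
  simp only [hmap, smul_eq_mul]
  rw [lintegral_prod _ (by fun_prop)]
  have h1 : ∀ r ∈ Ioi (0 : ℝ), ∫⁻ θ in Ioo (-Real.pi) Real.pi,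
      ENNReal.ofReal r * G (circleMap 0 r θ) = (Iio R).indicator (fun r => ENNReal.ofReal r *
        ∫⁻ θ in Ioo (-Real.pi) Real.pi, g (circleMap 0 r θ)) r := by
    intro r hr
    have hr0 : (0 : ℝ) < r := hr
    have hcr : Measurable fun θ => G (circleMap 0 r θ) :=
      hg.comp (continuous_circleMap 0 r).measurable
    by_cases hrR : r < R
    · rw [indicator_of_mem (show r ∈ Iio R from hrR),
        lintegral_const_mul _ hcr]
      refine congrArg _ (lintegral_congr fun θ => ?_)
      exact indicator_of_mem (by simpa [circleMap, abs_of_pos hr0] using hrR) g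
    · rw [indicator_of_notMem (show r ∉ Iio R from hrR)]
      refine lintegral_eq_zero_of_ae_eq_zero (ae_of_all _ fun θ => ?_)
      have : circleMap 0 r θ ∉ Metric.ball 0 R := by
        simpa [circleMap, abs_of_pos hr0] using hrR
      simp [hG, indicator_of_notMem this]
  rw [setLIntegral_congr_fun measurableSet_Ioi h1, lintegral_indicator measurableSet_Iio,
    Measure.restrict_restrict measurableSet_Iio, inter_comm, Ioi_inter_Iio]

/-- For ρ ≥ 1/2 the angle is controlled by |1 - ρe^{iθ}|² = (1 - ρ)² + 4ρ sin²(θ/2) and Jordan's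
inequality; for ρ < 1/2 the modulus exceeds 1/2, which is at least |θ|/(2π). -/
lemma norm_sub_circleMap_ge {ρ θ : ℝ} (h0 : 0 ≤ ρ) (h1 : ρ < 1) (hθ : |θ| ≤ Real.pi) :
    max |θ| (1 - ρ) / (2 * Real.pi) ≤ ‖1 - circleMap 0 ρ θ‖ := by
  have hpi := Real.pi_pos
  have hn1 : 1 - ρ ≤ ‖1 - circleMap 0 ρ θ‖ := by
    have := norm_sub_norm_le (1 : ℂ) (circleMap 0 ρ θ)
    simpa [circleMap, abs_of_nonneg h0] using this
  rw [div_le_iff₀ (by positivity)]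
  refine max_le ?_ ?_
  · by_cases hρ : ρ < 1 / 2
    · nlinarith [norm_nonneg (1 - circleMap 0 ρ θ)]
    · have hsq : ‖1 - circleMap 0 ρ θ‖ ^ 2 = (1 - ρ) ^ 2 + 4 * ρ * Real.sin (θ / 2) ^ 2 := by
        rw [← Complex.normSq_eq_norm_sq, Complex.normSq_apply]
        have hre : (1 - circleMap 0 ρ θ).re = 1 - ρ * Real.cos θ := by
          simp [circleMap, Complex.exp_ofReal_mul_I_re]
        have him : (1 - circleMap 0 ρ θ).im = - (ρ * Real.sin θ) := by
          simp [circleMap, Complex.exp_ofReal_mul_I_im]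
        rw [hre, him, Real.sin_sq_eq_half_sub, mul_div_cancel₀ _ two_ne_zero]
        nlinarith [Real.sin_sq_add_cos_sq θ]
      have hsin : |θ| / Real.pi ≤ |Real.sin (θ / 2)| := by
        have := Real.mul_abs_le_abs_sin (x := θ / 2) (by rw [abs_div, abs_two]; linarith)
        rw [abs_div, abs_two] at this
        calc |θ| / Real.pi = 2 / Real.pi * (|θ| / 2) := by ring
          _ ≤ _ := this
      have hle : |θ| / Real.pi ≤ ‖1 - circleMap 0 ρ θ‖ := by
        refine abs_le_of_sq_le_sq' ?_ (norm_nonneg _) |>.2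
        have h3 : (|θ| / Real.pi) ^ 2 ≤ Real.sin (θ / 2) ^ 2 := by
          rw [← sq_abs (Real.sin _)]
          exact pow_le_pow_left₀ (by positivity) hsin 2
        rw [hsq]
        nlinarith [sq_nonneg (1 - ρ), sq_nonneg (Real.sin (θ / 2))]
      rw [div_le_iff₀ hpi] at hle
      nlinarith [norm_nonneg (1 - circleMap 0 ρ θ)]
  · nlinarith [norm_nonneg (1 - circleMap 0 ρ θ), Real.pi_gt_three]

lemma lintegral_norm_one_sub_circleMap_rpow_le {b ρ : ℝ} (hb : 1 < b) (h0 : 0 ≤ ρ) (h1 : ρ < 1) :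
    ∫⁻ θ in Ioo (-Real.pi) Real.pi, ENNReal.ofReal (‖1 - circleMap 0 ρ θ‖ ^ (-b)) ≤
      ENNReal.ofReal (2 * (2 * Real.pi) ^ b * (1 + 1 / (b - 1)) * (1 - ρ) ^ (1 - b)) := by
  have hpi := Real.pi_pos
  have hv : 0 < 1 - ρ := by linarith
  have hb1 : 0 < b - 1 := by linarith
  have hw := Real.rpow_nonneg hv.le (1 - b)
  -- The factor `|θ| ^ (1 - 1)` equals 1 and brings the majorant into the shape of the one-variable
  -- integrals with a = 1.
  set k : ℝ → ℝ≥0∞ := fun θ => ENNReal.ofReal (|θ| ^ ((1 : ℝ) - 1) * max |θ| (1 - ρ) ^ (-b))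
  have hk : Measurable k := by fun_prop
  have hIoi : ∫⁻ θ in Ioi 0, k θ ≤ ENNReal.ofReal ((1 + 1 / (b - 1)) * (1 - ρ) ^ (1 - b)) := by
    have := lintegral_Ioi_rpow_mul_max_rpow_le one_pos hb hv
    rw [div_one] at this
    refine le_trans (le_of_eq (setLIntegral_congr_fun measurableSet_Ioi fun θ hθ => ?_)) this
    simp only [k, abs_of_pos (show (0 : ℝ) < θ from hθ)]
  have hIio : ∫⁻ θ in Iic 0, k θ = ∫⁻ θ in Ioi 0, k θ := by
    rw [setLIntegral_congr Iio_ae_eq_Iic.symm, ← lintegral_indicator measurableSet_Iio,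
      ← lintegral_indicator measurableSet_Ioi, ← lintegral_neg_eq_self]
    congr 1
    ext θ
    simp [indicator, k]
  calc _ ≤ ∫⁻ θ in Ioo (-Real.pi) Real.pi, ENNReal.ofReal ((2 * Real.pi) ^ b) * k θ := by
        refine setLIntegral_mono' measurableSet_Ioo fun θ hθ => ?_
        rw [← ENNReal.ofReal_mul (by positivity)]
        refine ENNReal.ofReal_le_ofReal ?_
        have hmax : 0 < max |θ| (1 - ρ) := lt_max_of_lt_right hv
        calc ‖1 - circleMap 0 ρ θ‖ ^ (-b) ≤ (max |θ| (1 - ρ) / (2 * Real.pi)) ^ (-b) :=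
              Real.rpow_le_rpow_of_nonpos (by positivity)
                (norm_sub_circleMap_ge h0 h1 (abs_le.2 ⟨hθ.1.le, hθ.2.le⟩)) (by linarith)
          _ = _ := by
              rw [sub_self, Real.rpow_zero, one_mul, Real.div_rpow hmax.le (by positivity),
                Real.rpow_neg (by positivity : 0 ≤ 2 * Real.pi), div_inv_eq_mul, mul_comm]
    _ ≤ ∫⁻ θ, ENNReal.ofReal ((2 * Real.pi) ^ b) * k θ := setLIntegral_le_lintegral _ _
    _ = ENNReal.ofReal ((2 * Real.pi) ^ b) *
          ((∫⁻ θ in Ioi 0, k θ) + ∫⁻ θ in Ioi 0, k θ) := by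
        rw [lintegral_const_mul _ hk, ← lintegral_add_compl k measurableSet_Ioi, compl_Ioi, hIio]
    _ ≤ _ := by
        refine (mul_le_mul' le_rfl (add_le_add hIoi hIoi)).trans (le_of_eq ?_)
        rw [← ENNReal.ofReal_add (by positivity) (by positivity),
          ← ENNReal.ofReal_mul (by positivity)]
        congr 1
        ring

/-- The Forelli–Rudin estimate, reduced to an integral over `(0, 1)`. -/
lemma lintegral_ball_norm_one_sub_rpow_le {b c t : ℝ} (hb : 1 < b) (ht0 : 0 ≤ t) (ht1 : t < 1) :
    ∫⁻ z in Metric.ball (0 : ℂ) 1, ENNReal.ofReal ((1 - ‖z‖) ^ c * ‖1 - t * z‖ ^ (-b)) ≤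
      ENNReal.ofReal (2 * (2 * Real.pi) ^ b * (1 + 1 / (b - 1))) *
        ∫⁻ u in Ioo 0 1, ENNReal.ofReal (u ^ c * max u (1 - t) ^ (1 - b)) := by
  have hpi := Real.pi_pos
  have hb1 : 0 < b - 1 := by linarith
  rw [lintegral_ball_eq_polar (Measurable.indicator (by fun_prop) measurableSet_ball),
    ← setLIntegral_Ioo_zero_one_comp_one_sub fun u => ENNReal.ofReal (u ^ c * max u _ ^ (1 - b)),
    ← lintegral_const_mul _ (by fun_prop)]
  refine setLIntegral_mono' measurableSet_Ioo fun r hr => ?_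
  have hr1 : 0 < 1 - r := by linarith [hr.2]
  have htr : t * r < 1 := by nlinarith [hr.1, hr.2]
  have hcongr : ∀ θ : ℝ, ENNReal.ofReal ((1 - ‖circleMap 0 r θ‖) ^ c *
      ‖1 - t * circleMap 0 r θ‖ ^ (-b)) = ENNReal.ofReal ((1 - r) ^ c) *
        ENNReal.ofReal (‖1 - circleMap 0 (t * r) θ‖ ^ (-b)) := fun θ => by
    rw [← ENNReal.ofReal_mul (by positivity)]
    simp [circleMap, abs_of_pos hr.1, mul_assoc]
  have hmeas : Measurable fun θ => ENNReal.ofReal (‖1 - circleMap 0 (t * r) θ‖ ^ (-b)) := by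
    unfold circleMap
    fun_prop
  simp only [hcongr]
  rw [lintegral_const_mul _ hmeas]
  calc _ ≤ 1 * (ENNReal.ofReal ((1 - r) ^ c) * ENNReal.ofReal (2 * (2 * Real.pi) ^ b *
        (1 + 1 / (b - 1)) * (1 - t * r) ^ (1 - b))) := by
        refine mul_le_mul' (by simpa using hr.2.le) (mul_le_mul' le_rfl ?_)
        exact lintegral_norm_one_sub_circleMap_rpow_le hb (mul_nonneg ht0 hr.1.le) htr
    _ ≤ _ := by
        rw [one_mul, ← ENNReal.ofReal_mul (by positivity), ← ENNReal.ofReal_mul (by positivity)]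
        refine ENNReal.ofReal_le_ofReal ?_
        -- The angular integral depends on 1 - t r, which dominates both 1 - r and 1 - t; with u = 1
        -- - r a one-variable integral remains.
        have : (1 - t * r) ^ (1 - b) ≤ max (1 - r) (1 - t) ^ (1 - b) := by
          refine Real.rpow_le_rpow_of_nonpos (lt_max_of_lt_left hr1) ?_ (by linarith)
          exact max_le (by nlinarith [hr.1, hr.2]) (by nlinarith [hr.1, hr.2])
        calc _ ≤ (1 - r) ^ c * (2 * (2 * Real.pi) ^ b * (1 + 1 / (b - 1)) *
              max (1 - r) (1 - t) ^ (1 - b)) := by gcongr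
          _ = _ := by ring

lemma exists_lintegral_ball_norm_one_sub_rpow_le {b c : ℝ} (hc : -1 < c) (hb : c + 2 < b) :
    ∃ C : ℝ, 0 < C ∧ ∀ t ∈ Ico (0 : ℝ) 1,
      ∫⁻ z in Metric.ball (0 : ℂ) 1, ENNReal.ofReal ((1 - ‖z‖) ^ c * ‖1 - t * z‖ ^ (-b)) ≤
        ENNReal.ofReal (C * (1 - t) ^ (c + 2 - b)) := by
  have hpi := Real.pi_pos
  have hb1 : 0 < b - 1 := by linarith
  have hc1 : 0 < c + 1 := by linarith
  have hcb : 0 < b - 1 - (c + 1) := by linarith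
  refine ⟨2 * (2 * Real.pi) ^ b * (1 + 1 / (b - 1)) * (1 / (c + 1) + 1 / (b - 1 - (c + 1))),
    by positivity, fun t ht => ?_⟩
  refine (lintegral_ball_norm_one_sub_rpow_le (by linarith) ht.1 ht.2).trans ?_
  rw [mul_assoc _ _ ((1 - t) ^ (_ : ℝ)),
    ENNReal.ofReal_mul (q := _ * (1 - t) ^ (c + 2 - b)) (by positivity)]
  refine mul_le_mul' le_rfl ?_
  have := lintegral_Ioi_rpow_mul_max_rpow_le hc1 (show c + 1 < b - 1 by linarith)
    (sub_pos.2 ht.2)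
  refine (lintegral_mono_set (Ioo_subset_Ioi_self (a := (1 : ℝ)) (b := 0))).trans ?_
  rwa [add_sub_cancel_right, neg_sub, show c + 1 - (b - 1) = c + 2 - b by ring] at this

lemma exists_lintegral_ball_norm_one_sub_rpow_le_log {c : ℝ} (hc : -1 < c) :
    ∃ C : ℝ, 0 < C ∧ ∀ t ∈ Ico (0 : ℝ) 1,
      ∫⁻ z in Metric.ball (0 : ℂ) 1, ENNReal.ofReal ((1 - ‖z‖) ^ c * ‖1 - t * z‖ ^ (-(c + 2))) ≤
        ENNReal.ofReal (C * (1 + Real.log (1 / (1 - t)))) := by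
  have hpi := Real.pi_pos
  have hc1 : 0 < c + 1 := by linarith
  have hc2 : 0 < c + 2 - 1 := by linarith
  refine ⟨2 * (2 * Real.pi) ^ (c + 2) * (1 + 1 / (c + 2 - 1)) * (1 / (c + 1) + 1),
    by positivity, fun t ht => ?_⟩
  refine (lintegral_ball_norm_one_sub_rpow_le (by linarith) ht.1 ht.2).trans ?_
  have hlog : 0 ≤ Real.log (1 / (1 - t)) :=
    Real.log_nonneg (by rw [le_div_iff₀ (by linarith [ht.2])]; linarith [ht.1])
  rw [mul_assoc _ _ (1 + Real.log _),
    ENNReal.ofReal_mul (q := _ * (1 + Real.log (1 / (1 - t)))) (by positivity)]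
  refine mul_le_mul' le_rfl ?_
  have := lintegral_Ioc_rpow_mul_max_rpow_neg_le hc1 (sub_pos.2 ht.2) (by linarith [ht.1])
  refine (lintegral_mono_set (Ioo_subset_Ioc_self (a := (1 : ℝ)) (b := 0))).trans (le_trans ?_
    (this.trans (ENNReal.ofReal_le_ofReal ?_)))
  · refine le_of_eq (lintegral_congr fun u => ?_)
    congr 3 <;> ring
  · have : 0 ≤ 1 / (c + 1) * Real.log (1 / (1 - t)) := by positivity
    linarith

/-! ### Cauchy estimates and mean value inequalities -/

/-- Cauchy's formula on the circle of radius r, moved to (-π, π) by periodicity to fit the polar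
coordinates above. -/
lemma ofReal_mul_enorm_taylorCoeff_le {f : ℂ → ℂ} {r R : ℝ}
    (hf : DifferentiableOn ℂ f (Metric.ball 0 R)) (hr : 0 < r) (hrR : r < R) (k : ℕ) :
    ENNReal.ofReal (2 * Real.pi * r ^ k) * ‖taylorCoeff f k‖ₑ ≤
      ∫⁻ θ in Ioo (-Real.pi) Real.pi, ‖f (circleMap 0 r θ)‖ₑ := by
  have hpi := Real.pi_pos
  have hc := (hf.mono (Metric.closedBall_subset_ball hrR)).circleIntegral_one_div_sub_center_pow_smul
    hr k
  have hcont : Continuous fun θ => f (circleMap 0 r θ) :=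
    hf.continuousOn.comp_continuous (continuous_circleMap 0 r) fun θ => by
      simpa [circleMap, abs_of_pos hr] using hrR
  have hcoef : (2 * Real.pi * Complex.I / (k.factorial : ℂ)) • iteratedDeriv k f 0 =
      2 * Real.pi * Complex.I * taylorCoeff f k := by
    simp only [taylorCoeff, smul_eq_mul]
    ring
  have hper : Function.Periodic (fun θ => ‖f (circleMap 0 r θ)‖) (2 * Real.pi) := fun θ => by
    simp only [periodic_circleMap 0 r θ]
  have hle : 2 * Real.pi * r ^ k * ‖taylorCoeff f k‖ ≤
      ∫ θ in (-Real.pi)..Real.pi, ‖f (circleMap 0 r θ)‖ := by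
    have h1 : 2 * Real.pi * ‖taylorCoeff f k‖ =
        ‖∮ z in C(0, r), (1 / (z - 0) ^ (k + 1)) • f z‖ := by
      rw [hc, hcoef]
      simp [abs_of_pos hpi]
    have h2 : ‖∮ z in C(0, r), (1 / (z - 0) ^ (k + 1)) • f z‖ ≤
        ∫ θ in 0..2 * Real.pi, (r ^ k)⁻¹ * ‖f (circleMap 0 r θ)‖ := by
      refine (intervalIntegral.norm_integral_le_integral_norm Real.two_pi_pos.le).trans
        (le_of_eq (intervalIntegral.integral_congr fun θ _ => ?_))
      simp [deriv_circleMap, abs_of_pos hr]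
      field_simp
      ring
    have h3 : ∫ θ in 0..2 * Real.pi, ‖f (circleMap 0 r θ)‖ =
        ∫ θ in (-Real.pi)..Real.pi, ‖f (circleMap 0 r θ)‖ := by
      have := hper.intervalIntegral_add_eq 0 (-Real.pi)
      rw [zero_add] at this
      rw [this]
      congr 1
      ring
    rw [intervalIntegral.integral_const_mul, h3, ← h1] at h2
    have hrk : 0 < r ^ k := pow_pos hr k
    calc _ = r ^ k * (2 * Real.pi * ‖taylorCoeff f k‖) := by ring
      _ ≤ r ^ k * ((r ^ k)⁻¹ * ∫ θ in (-Real.pi)..Real.pi, ‖f (circleMap 0 r θ)‖) := by gcongr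
      _ = _ := by rw [← mul_assoc, mul_inv_cancel₀ hrk.ne', one_mul]
  rw [← ofReal_norm, ← ENNReal.ofReal_mul (by positivity)]
  refine (ENNReal.ofReal_le_ofReal hle).trans (le_of_eq ?_)
  rw [intervalIntegral.integral_of_le (by linarith), ofReal_integral_eq_lintegral_ofReal
    (hcont.norm.integrableOn_Ioc) (ae_of_all _ fun _ => norm_nonneg _),
    setLIntegral_congr Ioo_ae_eq_Ioc]
  simp

lemma measurable_indicator_comp {f : ℂ → ℂ} {U : Set ℂ} (hf : ContinuousOn f U)
    (hU : MeasurableSet U) {φ : ℂ → ℝ≥0∞} (hφ : Measurable φ) :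
    Measurable (U.indicator fun z => φ (f z)) := by
  classical
  have h1 : Measurable (U.piecewise f fun _ => 0) := hf.measurable_piecewise continuousOn_const hU
  have h2 : U.indicator (fun z => φ (f z)) = U.indicator (φ ∘ U.piecewise f fun _ => 0) :=
    indicator_congr fun z hz => by simp [hz]
  rw [h2]
  exact (hφ.comp h1).indicator hU

/-- The Cauchy estimate for k = 0 integrated against r dr. -/
lemma ofReal_mul_enorm_le_lintegral_ball {f : ℂ → ℂ} {c : ℂ} {R : ℝ}
    (hf : DifferentiableOn ℂ f (Metric.ball c R)) (hR : 0 < R) :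
    ENNReal.ofReal (Real.pi * R ^ 2) * ‖f c‖ₑ ≤ ∫⁻ z in Metric.ball c R, ‖f z‖ₑ := by
  set g : ℂ → ℂ := fun z => f (z + c) with hg
  have hmaps : MapsTo (fun z : ℂ => z + c) (Metric.ball 0 R) (Metric.ball c R) := fun z hz => by
    simpa using hz
  have hgd : DifferentiableOn ℂ g (Metric.ball 0 R) :=
    hf.comp (by fun_prop) hmaps
  have hshift : ∫⁻ z in Metric.ball c R, ‖f z‖ₑ = ∫⁻ z in Metric.ball 0 R, ‖g z‖ₑ := by
    have := (measurePreserving_add_right volume c).setLIntegral_comp_preimage_emb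
      (MeasurableEquiv.addRight c).measurableEmbedding (fun z => ‖f z‖ₑ) (Metric.ball c R)
    rw [← this]
    congr 2
    ext z
    simp
  have hpolar := lintegral_ball_eq_polar (R := R) (g := fun z => ‖g z‖ₑ)
    (measurable_indicator_comp hgd.continuousOn measurableSet_ball measurable_enorm)
  have h0 : taylorCoeff g 0 = f c := by simp [taylorCoeff, hg]
  rw [hshift, hpolar]
  have hint : ∫⁻ r in Ioo 0 R, ENNReal.ofReal r = ENNReal.ofReal (R ^ 2 / 2) := by
    have := lintegral_Ioc_rpow_sub_one two_pos hR.le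
    norm_num at this
    rw [← this, setLIntegral_congr Ioo_ae_eq_Ioc]
  calc _ = ∫⁻ r in Ioo 0 R, ENNReal.ofReal r * (ENNReal.ofReal (2 * Real.pi) * ‖f c‖ₑ) := by
        rw [lintegral_mul_const _ (by fun_prop), hint, ← mul_assoc,
          ← ENNReal.ofReal_mul (by positivity)]
        congr 2
        ring
    _ ≤ _ := by
        refine setLIntegral_mono' measurableSet_Ioo fun r hr => mul_le_mul' le_rfl ?_
        simpa [h0] using ofReal_mul_enorm_taylorCoeff_le hgd hr.1 hr.2 0

lemma rpow_lintegral_le_mul_lintegral_rpow {X : Type*} [MeasurableSpace X] {ν : Measure X}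
    {p : ℝ} (hp : 1 ≤ p) {F : X → ℝ≥0∞} (hF : AEMeasurable F ν) :
    (∫⁻ x, F x ∂ν) ^ p ≤ ν univ ^ (p - 1) * ∫⁻ x, F x ^ p ∂ν := by
  rcases hp.eq_or_lt with rfl | hp
  · simp
  have hpq := Real.HolderConjugate.conjExponent hp
  have := ENNReal.lintegral_mul_le_Lp_mul_Lq ν hpq hF (g := fun _ => 1) aemeasurable_const
  simp only [Pi.mul_apply, mul_one, ENNReal.one_rpow, lintegral_const, one_mul] at this
  refine (ENNReal.rpow_le_rpow this (by linarith)).trans (le_of_eq ?_)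
  have hp0 : p ≠ 0 := by linarith
  have hp1 : p - 1 ≠ 0 := by linarith
  rw [ENNReal.mul_rpow_of_nonneg _ _ (by linarith), ← ENNReal.rpow_mul, ← ENNReal.rpow_mul,
    one_div_mul_cancel hp0, ENNReal.rpow_one, mul_comm]
  congr 2
  rw [Real.conjExponent]
  field_simp

/-- The case p = 1 combined with Hölder's inequality against the constant 1; the factor volume^(p -
1) cancels. -/
lemma ofReal_mul_enorm_rpow_le_lintegral_ball {f : ℂ → ℂ} {c : ℂ} {R p : ℝ} (hp : 1 ≤ p)
    (hf : DifferentiableOn ℂ f (Metric.ball c R)) (hR : 0 < R) :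
    ENNReal.ofReal (Real.pi * R ^ 2) * ‖f c‖ₑ ^ p ≤ ∫⁻ z in Metric.ball c R, ‖f z‖ₑ ^ p := by
  have hpi := Real.pi_pos
  set V := ENNReal.ofReal (Real.pi * R ^ 2) with hV
  have hV0 : V ≠ 0 := by
    rw [hV]
    exact (ENNReal.ofReal_pos.2 (by positivity)).ne'
  have hVt : V ≠ ∞ := ENNReal.ofReal_ne_top
  have hvol : volume (Metric.ball c R) = V := by
    rw [Complex.volume_ball, hV, mul_comm, ENNReal.ofReal_mul hpi.le, ENNReal.ofReal_pow hR.le]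
    congr 1
    exact (ENNReal.ofReal_coe_nnreal (p := NNReal.pi)).symm
  have h1 := ENNReal.rpow_le_rpow (ofReal_mul_enorm_le_lintegral_ball hf hR)
    (show 0 ≤ p by linarith)
  have h2 := h1.trans (rpow_lintegral_le_mul_lintegral_rpow hp
    (hf.continuousOn.aestronglyMeasurable measurableSet_ball).enorm)
  rw [Measure.restrict_apply_univ, hvol, ENNReal.mul_rpow_of_nonneg _ _ (by linarith)] at h2
  have hsplit : V ^ p = V ^ (p - 1) * V := by
    conv_rhs => rw [← ENNReal.rpow_one V, ← ENNReal.rpow_mul, one_mul]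
    rw [← ENNReal.rpow_add _ _ hV0 hVt, sub_add_cancel]
  rw [hsplit, mul_assoc] at h2
  exact (ENNReal.mul_le_mul_iff_right (by simp [ENNReal.rpow_eq_zero_iff, hV0, hVt])
    (ENNReal.rpow_ne_top_of_ne_zero hV0 hVt)).1 h2

/-! ### The weighted area measure and the Bergman norm -/

/-- The area measure on the unit disc with weight `(1 - |z| ^ 2) ^ α`. -/
noncomputable def diskMeasure (α : ℝ) : Measure ℂ :=
  (volume.restrict (Metric.ball 0 1)).withDensity fun z => ENNReal.ofReal ((1 - ‖z‖ ^ 2) ^ α)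

lemma lintegral_diskMeasure (α : ℝ) (F : ℂ → ℝ≥0∞) :
    ∫⁻ z, F z ∂diskMeasure α =
      ∫⁻ z in Metric.ball (0 : ℂ) 1, F z * ENNReal.ofReal ((1 - ‖z‖ ^ 2) ^ α) := by
  rw [diskMeasure, lintegral_withDensity_eq_lintegral_mul_non_measurable _ (by fun_prop)
    (ae_of_all _ fun _ => ENNReal.ofReal_lt_top)]
  simp [mul_comm]

lemma aemeasurable_diskMeasure {α : ℝ} {F : ℂ → ℝ≥0∞}
    (hF : Measurable ((Metric.ball (0 : ℂ) 1).indicator F)) : AEMeasurable F (diskMeasure α) := by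
  refine AEMeasurable.mono_ac ?_ (withDensity_absolutelyContinuous _ _)
  exact (aemeasurable_indicator_iff measurableSet_ball).1 hF.aemeasurable

instance sFinite_diskMeasure (α : ℝ) : SFinite (diskMeasure α) := by
  unfold diskMeasure
  infer_instance

lemma bergmanNorm_eq (p α : ℝ) (hp : 0 ≤ p) (f : ℂ → ℂ) :
    bergmanNorm p α f = (ENNReal.ofReal ((α + 1) / Real.pi) *
      ∫⁻ z, ‖f z‖ₑ ^ p ∂diskMeasure α) ^ (1 / p) := by
  rw [bergmanNorm, lintegral_diskMeasure]
  congr 2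
  refine setLIntegral_congr_fun measurableSet_ball fun z hz => ?_
  rw [ENNReal.ofReal_mul (by positivity), ← ENNReal.ofReal_rpow_of_nonneg (norm_nonneg _) hp,
    ofReal_norm]

lemma bergmanNorm_lt_top_iff {p α : ℝ} (hp : 0 < p) (hα : -1 < α) (f : ℂ → ℂ) :
    bergmanNorm p α f < ∞ ↔ ∫⁻ z, ‖f z‖ₑ ^ p ∂diskMeasure α < ∞ := by
  have h0 : 0 < (α + 1) / Real.pi := div_pos (by linarith) Real.pi_pos
  rw [bergmanNorm_eq p α hp.le, ENNReal.rpow_lt_top_iff_of_pos (by positivity)]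
  constructor
  · intro h
    by_contra hcon
    rw [not_lt, top_le_iff] at hcon
    rw [hcon, ENNReal.mul_top (ENNReal.ofReal_pos.2 h0).ne'] at h
    exact lt_irrefl _ h
  · exact fun h => ENNReal.mul_lt_top ENNReal.ofReal_lt_top h

lemma bergmanNorm_le_mul_iff {p α : ℝ} (hp : 0 < p) (hα : -1 < α) (f g : ℂ → ℂ) (C : ℝ≥0) :
    bergmanNorm p α f ≤ C * bergmanNorm p α g ↔
      ∫⁻ z, ‖f z‖ₑ ^ p ∂diskMeasure α ≤ (C : ℝ≥0∞) ^ p * ∫⁻ z, ‖g z‖ₑ ^ p ∂diskMeasure α := by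
  have h0 : 0 < (α + 1) / Real.pi := div_pos (by linarith) Real.pi_pos
  rw [bergmanNorm_eq p α hp.le, bergmanNorm_eq p α hp.le,
    ← ENNReal.rpow_le_rpow_iff hp, ENNReal.mul_rpow_of_nonneg _ _ hp.le, ← ENNReal.rpow_mul,
    ← ENNReal.rpow_mul, one_div_mul_cancel hp.ne', ENNReal.rpow_one, ENNReal.rpow_one,
    mul_left_comm, ENNReal.mul_le_mul_iff_right (ENNReal.ofReal_pos.2 h0).ne'
    ENNReal.ofReal_ne_top]

lemma one_sub_sq_rpow_le {x : ℝ} (a : ℝ) (h0 : 0 ≤ x) (h1 : x < 1) :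
    (1 - x ^ 2) ^ a ≤ 2 ^ |a| * (1 - x) ^ a := by
  have hx : 0 < 1 - x := by linarith
  rw [show 1 - x ^ 2 = (1 + x) * (1 - x) by ring, Real.mul_rpow (by linarith) hx.le]
  gcongr
  exact (Real.rpow_le_rpow_of_exponent_le (by linarith) (le_abs_self a)).trans
    (Real.rpow_le_rpow (by linarith) (by linarith) (abs_nonneg a))

lemma one_sub_rpow_le {x : ℝ} (a : ℝ) (h0 : 0 ≤ x) (h1 : x < 1) :
    (1 - x) ^ a ≤ 2 ^ |a| * (1 - x ^ 2) ^ a := by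
  have hx : 0 < 1 - x := by linarith
  have h2 : 0 < 1 - x ^ 2 := by nlinarith
  have h3 : (1 - x) ^ a = (1 + x) ^ (-a) * (1 - x ^ 2) ^ a := by
    rw [show 1 - x ^ 2 = (1 + x) * (1 - x) by ring, Real.mul_rpow (by linarith) hx.le,
      Real.rpow_neg (by linarith), inv_mul_cancel_left₀]
    exact (Real.rpow_pos_of_pos (by linarith) _).ne'
  rw [h3]
  gcongr
  exact (Real.rpow_le_rpow_of_exponent_le (by linarith) (neg_le_abs a)).trans
    (Real.rpow_le_rpow (by linarith) (by linarith) (abs_nonneg a))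

lemma lintegral_diskMeasure_le (α : ℝ) (F : ℂ → ℝ≥0∞) :
    ∫⁻ z, F z ∂diskMeasure α ≤ ENNReal.ofReal (2 ^ |α|) *
      ∫⁻ z in Metric.ball (0 : ℂ) 1, F z * ENNReal.ofReal ((1 - ‖z‖) ^ α) := by
  rw [lintegral_diskMeasure, ← lintegral_const_mul' _ _ ENNReal.ofReal_ne_top]
  refine setLIntegral_mono' measurableSet_ball fun z hz => ?_
  rw [mul_left_comm, ← ENNReal.ofReal_mul (by positivity)]
  exact mul_le_mul' le_rfl (ENNReal.ofReal_le_ofReal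
    (one_sub_sq_rpow_le α (norm_nonneg z) (by simpa using hz)))

lemma le_lintegral_diskMeasure (α : ℝ) (F : ℂ → ℝ≥0∞) :
    ∫⁻ z in Metric.ball (0 : ℂ) 1, F z * ENNReal.ofReal ((1 - ‖z‖) ^ α) ≤
      ENNReal.ofReal (2 ^ |α|) * ∫⁻ z, F z ∂diskMeasure α := by
  rw [lintegral_diskMeasure, ← lintegral_const_mul' _ _ ENNReal.ofReal_ne_top]
  refine setLIntegral_mono' measurableSet_ball fun z hz => ?_
  rw [mul_left_comm, ← ENNReal.ofReal_mul (by positivity)]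
  exact mul_le_mul' le_rfl (ENNReal.ofReal_le_ofReal
    (one_sub_rpow_le α (norm_nonneg z) (by simpa using hz)))

/-! ### Carleson measures on the radius -/

/-- `ν` satisfies the `s`-Carleson condition with constant `C`. -/
def TailBound (s C : ℝ) (ν : Measure ℝ) : Prop :=
  ∀ t ∈ Ico (0 : ℝ) 1, ν (Ico t 1) ≤ ENNReal.ofReal (C * (1 - t) ^ s)

lemma TailBound.ne_top {s C : ℝ} {ν : Measure ℝ} (h : TailBound s C ν) : ν (Ico 0 1) ≠ ∞ :=
  ((h 0 ⟨le_rfl, one_pos⟩).trans_lt ENNReal.ofReal_lt_top).ne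

lemma TailBound.measure_Ico_max_le {s C x : ℝ} {ν : Measure ℝ} (h : TailBound s C ν)
    (hs : 0 ≤ s) (hC : 0 ≤ C) (h1 : x < 1) :
    ν (Ico (max (2 * x - 1) 0) 1) ≤ ENNReal.ofReal (C * 2 ^ s * (1 - x) ^ s) := by
  have hm : max (2 * x - 1) 0 < 1 := max_lt (by linarith) one_pos
  refine (h _ ⟨le_max_right _ _, hm⟩).trans (ENNReal.ofReal_le_ofReal ?_)
  rw [mul_assoc, ← Real.mul_rpow two_pos.le (by linarith)]
  gcongr
  linarith [le_max_left (2 * x - 1) 0]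

/-- The Carleson embedding theorem for measures on the radius. -/
lemma TailBound.lintegral_enorm_rpow_le {α p C : ℝ} (hα : -2 < α) (hp : 1 ≤ p) (hC : 0 ≤ C)
    {ν : Measure ℝ} (hν : TailBound (α + 2) C ν) {f : ℂ → ℂ}
    (hf : DifferentiableOn ℂ f (Metric.ball 0 1)) :
    ∫⁻ t in Ico (0 : ℝ) 1, ‖f t‖ₑ ^ p ∂ν ≤
      ENNReal.ofReal (9 / Real.pi * C * 2 ^ (α + 2) * 2 ^ |α|) *
        ∫⁻ z, ‖f z‖ₑ ^ p ∂diskMeasure α := by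
  have hpi := Real.pi_pos
  have : IsFiniteMeasure (ν.restrict (Ico 0 1)) := ⟨by simpa using hν.ne_top.lt_top⟩
  -- |f(t)|^p is averaged over the disc of centre t and radius ρ = (1 - t)/2. There 1 - |w| ≤ 3ρ, so
  -- 1/(πρ²) ≤ 9/(π(1 - |w|)²). A point w meets only those t with t > 2|w| - 1; their mass is O((1 -
  -- |w|)^(α + 2)), and the weight (1 - |w|)^α is left.
  set S : Set (ℝ × ℂ) := {q | ‖q.2 - q.1‖ < (1 - q.1) / 2} with hSdef
  have hS : MeasurableSet S := measurableSet_lt (by fun_prop) (by fun_prop)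
  set h : ℂ → ℝ≥0∞ := (Metric.ball 0 1).indicator fun z => ‖f z‖ₑ ^ p with hh
  have hmeas : Measurable h := measurable_indicator_comp hf.continuousOn measurableSet_ball
    (φ := fun z => ‖z‖ₑ ^ p) (by fun_prop)
  set k : ℂ → ℝ≥0∞ := fun w => h w * ENNReal.ofReal (9 / (Real.pi * (1 - ‖w‖) ^ 2)) with hk
  have hkm : Measurable k := by fun_prop
  set F : ℝ → ℂ → ℝ≥0∞ := fun t w => S.indicator (fun q => k q.2) (t, w) with hFdef
  have hF : Measurable (Function.uncurry F) := (hkm.comp measurable_snd).indicator hS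
  calc ∫⁻ t in Ico (0 : ℝ) 1, ‖f t‖ₑ ^ p ∂ν
      ≤ ∫⁻ t in Ico (0 : ℝ) 1, ∫⁻ w, F t w ∂volume ∂ν := by
        refine setLIntegral_mono' measurableSet_Ico fun t ht => ?_
        have ht1 : 0 < 1 - t := by linarith [ht.2]
        set ρ := (1 - t) / 2 with hρ
        have hρ0 : 0 < ρ := by positivity
        have hnt : ‖(t : ℂ)‖ = t := by simp [abs_of_nonneg ht.1]
        have hsub : Metric.ball (t : ℂ) ρ ⊆ Metric.ball 0 1 := by
          refine Metric.ball_subset_ball' ?_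
          rw [dist_zero_right, hnt]
          linarith
        have hmean := ofReal_mul_enorm_rpow_le_lintegral_ball hp (hf.mono hsub) hρ0
        have h1 : ENNReal.ofReal (1 / (Real.pi * ρ ^ 2)) *
            ENNReal.ofReal (Real.pi * ρ ^ 2) = 1 := by
          rw [← ENNReal.ofReal_mul (by positivity), one_div_mul_cancel (by positivity),
            ENNReal.ofReal_one]
        calc ‖f t‖ₑ ^ p = ENNReal.ofReal (1 / (Real.pi * ρ ^ 2)) *
              (ENNReal.ofReal (Real.pi * ρ ^ 2) * ‖f t‖ₑ ^ p) := by
              rw [← mul_assoc, h1, one_mul]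
          _ ≤ ENNReal.ofReal (1 / (Real.pi * ρ ^ 2)) *
              ∫⁻ w in Metric.ball (t : ℂ) ρ, ‖f w‖ₑ ^ p := mul_le_mul' le_rfl hmean
          _ = ∫⁻ w in Metric.ball (t : ℂ) ρ, ENNReal.ofReal (1 / (Real.pi * ρ ^ 2)) *
              ‖f w‖ₑ ^ p := (lintegral_const_mul' _ _ ENNReal.ofReal_ne_top).symm
          _ ≤ ∫⁻ w in Metric.ball (t : ℂ) ρ, F t w := by
              refine setLIntegral_mono' measurableSet_ball fun w hw => ?_
              have hwS : (t, w) ∈ S := by simpa [hSdef, Complex.dist_eq] using hw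
              have hw1 : ‖w‖ < 1 := by simpa using hsub hw
              have hw' : ‖w - t‖ < ρ := hwS
              have hlow : 1 - ‖w‖ ≤ 3 * ρ := by
                have := norm_sub_norm_le (t : ℂ) w
                rw [hnt, norm_sub_rev] at this
                linarith
              simp only [hFdef]
              rw [indicator_of_mem hwS, mul_comm, hk, hh]
              simp only
              rw [indicator_of_mem (hsub hw)]
              refine mul_le_mul' le_rfl (ENNReal.ofReal_le_ofReal ?_)
              have hw2 : 0 < 1 - ‖w‖ := by linarith
              rw [div_le_div_iff₀ (by positivity) (by positivity)]
              have : (1 - ‖w‖) ^ 2 ≤ (3 * ρ) ^ 2 := pow_le_pow_left₀ hw2.le hlow 2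
              nlinarith
          _ ≤ _ := setLIntegral_le_lintegral _ _
    _ = ∫⁻ w, ∫⁻ t in Ico (0 : ℝ) 1, F t w ∂ν := lintegral_lintegral_swap hF.aemeasurable
    _ ≤ ∫⁻ w, (Metric.ball (0 : ℂ) 1).indicator (fun w => ‖f w‖ₑ ^ p *
          (ENNReal.ofReal (9 / Real.pi * C * 2 ^ (α + 2)) *
            ENNReal.ofReal ((1 - ‖w‖) ^ α))) w := by
        refine lintegral_mono fun w => ?_
        by_cases hw : w ∈ Metric.ball (0 : ℂ) 1
        · have hw1 : ‖w‖ < 1 := by simpa using hw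
          have hw2 : 0 < 1 - ‖w‖ := by linarith
          rw [indicator_of_mem hw]
          calc ∫⁻ t in Ico (0 : ℝ) 1, F t w ∂ν
              ≤ ∫⁻ t in Ico (0 : ℝ) 1, (Ico (max (2 * ‖w‖ - 1) 0) 1).indicator
                  (fun _ => k w) t ∂ν := by
                refine setLIntegral_mono' measurableSet_Ico fun t ht => ?_
                simp only [hFdef]
                by_cases hq : (t, w) ∈ S
                · have hq' : ‖w - t‖ < (1 - t) / 2 := hq
                  have hnt : ‖(t : ℂ)‖ = t := by simp [abs_of_nonneg ht.1]
                  have := norm_sub_norm_le w (t : ℂ)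
                  rw [hnt] at this
                  have htm : t ∈ Ico (max (2 * ‖w‖ - 1) 0) 1 :=
                    ⟨max_le (by linarith) ht.1, ht.2⟩
                  rw [indicator_of_mem hq, indicator_of_mem htm]
                · rw [indicator_of_notMem hq]
                  exact zero_le
            _ ≤ k w * ν (Ico (max (2 * ‖w‖ - 1) 0) 1) := by
                refine (setLIntegral_le_lintegral _ _).trans ?_
                rw [lintegral_indicator_const measurableSet_Ico]
            _ ≤ k w * ENNReal.ofReal (C * 2 ^ (α + 2) * (1 - ‖w‖) ^ (α + 2)) :=
                mul_le_mul' le_rfl (hν.measure_Ico_max_le (by linarith) hC hw1)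
            _ = _ := by
                simp only [hk, hh]
                rw [indicator_of_mem hw, mul_assoc, ← ENNReal.ofReal_mul (by positivity),
                  ← ENNReal.ofReal_mul (by positivity)]
                congr 2
                rw [Real.rpow_add hw2, Real.rpow_two]
                field_simp
        · rw [indicator_of_notMem hw]
          refine (lintegral_eq_zero_of_ae_eq_zero (ae_of_all _ fun t => ?_)).le
          simp [hFdef, hk, hh, indicator_of_notMem hw, indicator_apply]
    _ = ENNReal.ofReal (9 / Real.pi * C * 2 ^ (α + 2)) * ∫⁻ w in Metric.ball (0 : ℂ) 1,
          ‖f w‖ₑ ^ p * ENNReal.ofReal ((1 - ‖w‖) ^ α) := by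
        rw [lintegral_indicator measurableSet_ball,
          ← lintegral_const_mul' _ _ ENNReal.ofReal_ne_top]
        simp only [mul_left_comm]
    _ ≤ _ := by
        refine (mul_le_mul' le_rfl (le_lintegral_diskMeasure α _)).trans (le_of_eq ?_)
        rw [← mul_assoc, ← ENNReal.ofReal_mul (by positivity)]

/-- On increasing functions an s-Carleson measure is dominated by (1 - t)^(s - 1) dt, because only
its tails matter. The constant 2^(s + 1) is 2 from the averaging times 2^s from evaluating the tail
at 2x - 1. -/
lemma TailBound.lintegral_monotone_le {s C : ℝ} (hs : 0 ≤ s) (hC : 0 ≤ C) {ν : Measure ℝ}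
    (hν : TailBound s C ν) {K : ℝ → ℝ≥0∞} (hK : Measurable K) (hmono : MonotoneOn K (Ico 0 1)) :
    ∫⁻ t in Ico 0 1, K t ∂ν ≤ ENNReal.ofReal (C * 2 ^ (s + 1)) *
      ∫⁻ u in Ioo 0 1, ENNReal.ofReal (u ^ (s - 1)) * K (1 - u) := by
  refine (lintegral_Ico_le_lintegral_tail hν.ne_top hK hmono).trans ?_
  rw [← lintegral_const_mul' _ _ ENNReal.ofReal_ne_top,
    ← setLIntegral_Ioo_zero_one_comp_one_sub]
  refine setLIntegral_mono' measurableSet_Ioo fun u hu => ?_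
  have hu0 := hu.1
  refine (mul_le_mul' le_rfl (mul_le_mul' le_rfl
    (hν.measure_Ico_max_le hs hC (by linarith [hu.1])))).trans (le_of_eq ?_)
  rw [sub_sub_cancel, mul_comm, ← mul_assoc, ← ENNReal.ofReal_mul (by positivity),
    ← ENNReal.ofReal_mul (by positivity)]
  congr 2
  rw [Real.rpow_sub_one hu0.ne', Real.rpow_add_one two_ne_zero]
  ring

/-! ### Growth of Taylor coefficients and convergence of Taylor polynomials in L¹(μ) -/

/-- Cauchy's estimate is integrated over the annulus 1 - r < η = 1/(2(k + 1)), where r^k ≥ 1/2 by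
Bernoulli's inequality; the weight contributes η^(α + 1). The integral is kept on the annulus so
that it can be shown to vanish as k grows. -/
lemma exists_ofReal_mul_enorm_taylorCoeff_le {α : ℝ} (hα : -1 < α) :
    ∃ c : ℝ, 0 < c ∧ ∀ f : ℂ → ℂ, DifferentiableOn ℂ f (Metric.ball 0 1) → ∀ k : ℕ,
      ENNReal.ofReal (c * ((k : ℝ) + 1) ^ (-(α + 1))) * ‖taylorCoeff f k‖ₑ ≤
        ∫⁻ z, {z : ℂ | 1 - 1 / (2 * ((k : ℝ) + 1)) < ‖z‖}.indicator (fun z => ‖f z‖ₑ) z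
          ∂diskMeasure α := by
  have hpi := Real.pi_pos
  have hα1 : 0 < α + 1 := by linarith
  -- Here π/2 = 2π · 1/2 · 1/2 collects Cauchy's constant and the lower bounds for r^k and for the
  -- Jacobian r; 2^|α| exchanges 1 - r and 1 - r² in the weight; the last factor is the integral of
  -- u^α over (0, η) without its power of k + 1.
  refine ⟨Real.pi / 2 * (2 ^ |α|)⁻¹ * ((2⁻¹ : ℝ) ^ (α + 1) / (α + 1)), by positivity,
    fun f hf k => ?_⟩
  set η : ℝ := 1 / (2 * ((k : ℝ) + 1)) with hη
  have hη0 : 0 < η := by positivity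
  have hη1 : η ≤ 1 / 2 := by
    rw [hη, div_le_div_iff₀ (by positivity) two_pos]
    linarith [Nat.cast_nonneg (α := ℝ) k]
  set A : Set ℂ := {z : ℂ | 1 - η < ‖z‖} with hA
  have hAm : MeasurableSet A := measurableSet_lt (by fun_prop) (by fun_prop)
  have hmeas : Measurable ((Metric.ball (0 : ℂ) 1).indicator fun z =>
      A.indicator (fun z => ‖f z‖ₑ) z * ENNReal.ofReal ((1 - ‖z‖ ^ 2) ^ α)) := by
    have h1 := (measurable_indicator_comp hf.continuousOn measurableSet_ball
      measurable_enorm).indicator hAm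
    have h2 : (Metric.ball (0 : ℂ) 1).indicator (fun z =>
        A.indicator (fun z => ‖f z‖ₑ) z * ENNReal.ofReal ((1 - ‖z‖ ^ 2) ^ α)) = fun z =>
        A.indicator ((Metric.ball (0 : ℂ) 1).indicator fun z => ‖f z‖ₑ) z *
          ENNReal.ofReal ((1 - ‖z‖ ^ 2) ^ α) := by
      ext z
      by_cases hz : z ∈ Metric.ball (0 : ℂ) 1 <;> by_cases hzA : z ∈ A <;>
        simp only [indicator, hz, hzA, if_true, if_false, zero_mul]
    rw [h2]
    fun_prop
  rw [lintegral_diskMeasure, lintegral_ball_eq_polar hmeas]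
  set κ := Real.pi / 2 * (2 ^ |α|)⁻¹ with hκ
  have hκ0 : 0 < κ := by positivity
  calc _ = ENNReal.ofReal κ * ‖taylorCoeff f k‖ₑ *
        ∫⁻ u in Ioo 0 1, (Ioo 0 η).indicator (fun u => ENNReal.ofReal (u ^ α)) u := by
        rw [lintegral_indicator measurableSet_Ioo, Measure.restrict_restrict measurableSet_Ioo,
          inter_eq_left.2 (Ioo_subset_Ioo_right (by linarith)), setLIntegral_congr Ioo_ae_eq_Ioc]
        have := lintegral_Ioc_rpow_sub_one hα1 hη0.le
        rw [add_sub_cancel_right] at this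
        rw [this, mul_right_comm (ENNReal.ofReal κ), ← ENNReal.ofReal_mul hκ0.le]
        congr 2
        rw [hη, one_div, mul_inv, Real.mul_rpow (by norm_num) (by positivity),
          Real.inv_rpow (by positivity : 0 ≤ (k : ℝ) + 1), Real.rpow_neg (by positivity)]
        ring
    _ = ∫⁻ r in Ioo 0 1, ENNReal.ofReal κ * ‖taylorCoeff f k‖ₑ *
          (Ioo 0 η).indicator (fun u => ENNReal.ofReal (u ^ α)) (1 - r) := by
        rw [lintegral_const_mul' _ _ (ENNReal.mul_ne_top ENNReal.ofReal_ne_top enorm_ne_top),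
          setLIntegral_Ioo_zero_one_comp_one_sub]
    _ ≤ _ := by
        refine setLIntegral_mono' measurableSet_Ioo fun r hr => ?_
        by_cases hrη : 1 - r ∈ Ioo 0 η
        · rw [indicator_of_mem hrη]
          have hn : ∀ θ, ‖circleMap 0 r θ‖ = r := fun θ => by simp [abs_of_pos hr.1]
          have hin : ∀ θ, circleMap 0 r θ ∈ A := fun θ => by
            rw [hA, mem_ofPred_eq, hn]
            linarith [hrη.2]
          have hr1 := hr.1
          have hw : 0 ≤ (1 - r ^ 2) ^ α := Real.rpow_nonneg (by nlinarith [hr.2]) _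
          simp only [indicator_of_mem (hin _), hn]
          rw [lintegral_mul_const' _ _ ENNReal.ofReal_ne_top]
          refine le_trans ?_ (mul_le_mul' le_rfl (mul_le_mul'
            (ofReal_mul_enorm_taylorCoeff_le hf hr.1 hr.2 k) le_rfl))
          rw [mul_right_comm, mul_right_comm _ _ (ENNReal.ofReal ((1 - r ^ 2) ^ α)), ← mul_assoc,
            ← ENNReal.ofReal_mul hκ0.le, ← ENNReal.ofReal_mul (by positivity),
            ← ENNReal.ofReal_mul (by positivity)]
          refine mul_le_mul' (ENNReal.ofReal_le_ofReal ?_) le_rfl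
          have hpow : 1 / 2 ≤ r ^ k := by
            have hb := one_add_mul_le_pow (a := -η) (by linarith) k
            have hkη : k * η ≤ 1 / 2 := by
              rw [hη, mul_one_div, div_le_div_iff₀ (by positivity) two_pos]
              linarith
            calc (1 : ℝ) / 2 ≤ 1 + k * -η := by linarith
              _ ≤ (1 + -η) ^ k := hb
              _ ≤ r ^ k := pow_le_pow_left₀ (by linarith) (by linarith [hrη.2]) k
          have hweight := one_sub_rpow_le α hr.1.le hr.2
          have hr2 : 1 / 2 ≤ r := by linarith [hrη.2]
          have h2 : (2 ^ |α|)⁻¹ * (1 - r) ^ α ≤ (1 - r ^ 2) ^ α := by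
            rw [inv_mul_le_iff₀ (by positivity)]
            exact hweight
          calc κ * (1 - r) ^ α = 1 / 2 * (2 * Real.pi * (1 / 2)) *
                ((2 ^ |α|)⁻¹ * (1 - r) ^ α) := by rw [hκ]; ring
            _ ≤ r * (2 * Real.pi * r ^ k) * (1 - r ^ 2) ^ α := by
              have : 0 ≤ (1 - r) ^ α := Real.rpow_nonneg hrη.1.le _
              gcongr
            _ = _ := by ring
        · rw [indicator_of_notMem hrη, mul_zero]
          exact zero_le

lemma ae_mem_ball_diskMeasure (α : ℝ) : ∀ᵐ z ∂diskMeasure α, z ∈ Metric.ball (0 : ℂ) 1 :=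
  (withDensity_absolutelyContinuous _ _).ae_le (ae_restrict_mem measurableSet_ball)

/-- The annuli shrink to the boundary circle, so dominated convergence improves O to o. The
convergence of Taylor polynomials below depends on this gain. -/
lemma tendsto_norm_taylorCoeff_mul_rpow {α : ℝ} (hα : -1 < α) {f : ℂ → ℂ}
    (hf : DifferentiableOn ℂ f (Metric.ball 0 1)) (hfin : ∫⁻ z, ‖f z‖ₑ ∂diskMeasure α ≠ ∞) :
    Tendsto (fun k : ℕ => ‖taylorCoeff f k‖ * ((k : ℝ) + 1) ^ (-(α + 1))) atTop (𝓝 0) := by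
  obtain ⟨c, hc, hle⟩ := exists_ofReal_mul_enorm_taylorCoeff_le hα
  set A : ℕ → Set ℂ := fun k => {z : ℂ | 1 - 1 / (2 * ((k : ℝ) + 1)) < ‖z‖} with hA
  have hAm : ∀ k, MeasurableSet (A k) := fun k => measurableSet_lt (by fun_prop) (by fun_prop)
  have hlim : Tendsto (fun k => ∫⁻ z, (A k).indicator (fun z => ‖f z‖ₑ) z ∂diskMeasure α) atTop
      (𝓝 (∫⁻ _, 0 ∂diskMeasure α)) := by
    refine tendsto_lintegral_of_dominated_convergence' (fun z => ‖f z‖ₑ) (fun k => ?_) (fun k => ?_)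
      hfin ?_
    · exact (aemeasurable_diskMeasure (measurable_indicator_comp hf.continuousOn
        measurableSet_ball measurable_enorm)).indicator (hAm k)
    · exact ae_of_all _ fun z => indicator_le_self _ _ z
    · filter_upwards [ae_mem_ball_diskMeasure α] with z hz
      have hz1 : ‖z‖ < 1 := by simpa using hz
      have h1 : Tendsto (fun k : ℕ => 1 - 1 / (2 * ((k : ℝ) + 1))) atTop (𝓝 1) := by
        have := (tendsto_one_div_add_atTop_nhds_zero_nat (𝕜 := ℝ)).const_mul (1 / 2)
        simpa [mul_comm] using this.const_sub 1
      refine tendsto_const_nhds.congr' ?_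
      filter_upwards [h1.eventually (lt_mem_nhds hz1)] with k hk
      rw [indicator_of_notMem]
      simp only [hA, mem_ofPred_eq, not_lt]
      exact hk.le
  rw [lintegral_zero] at hlim
  have h2 : Tendsto (fun k : ℕ => ENNReal.ofReal
      (c * (‖taylorCoeff f k‖ * ((k : ℝ) + 1) ^ (-(α + 1))))) atTop (𝓝 0) := by
    refine tendsto_of_tendsto_of_tendsto_of_le_of_le tendsto_const_nhds hlim
      (fun _ => zero_le) fun k => ?_
    refine le_trans (le_of_eq ?_) (hle f hf k)
    rw [← ofReal_norm, ← ENNReal.ofReal_mul (by positivity)]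
    congr 1
    ring
  have h3 := (ENNReal.tendsto_toReal ENNReal.zero_ne_top).comp h2
  have h4 := h3.const_mul c⁻¹
  simp only [ENNReal.toReal_zero, mul_zero] at h4
  refine h4.congr fun k => ?_
  simp only [Function.comp]
  rw [ENNReal.toReal_ofReal (by positivity), inv_mul_cancel_left₀ hc.ne']

lemma hasSum_taylorCoeff {f : ℂ → ℂ} {R : ℝ} (hf : DifferentiableOn ℂ f (Metric.ball 0 R)) {z : ℂ}
    (hz : z ∈ Metric.ball 0 R) : HasSum (fun k => taylorCoeff f k * z ^ k) (f z) := by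
  have := Complex.hasSum_taylorSeries_on_ball hf hz
  simp only [smul_eq_mul, sub_zero] at this
  refine this.congr_fun fun k => ?_
  rw [taylorCoeff]
  ring

/-- Comparison with the binomial series of (1 - t)^(-(L + 1)), from (k + 1)^L ≤ (k + 1)(k + 2)⋯(k +
L). -/
lemma tsum_add_one_pow_mul_pow_le (L : ℕ) {t : ℝ} (h0 : 0 ≤ t) (h1 : t < 1) :
    (Summable fun k : ℕ => ((k : ℝ) + 1) ^ L * t ^ k) ∧
      ∑' k : ℕ, ((k : ℝ) + 1) ^ L * t ^ k ≤ L.factorial * (1 / (1 - t) ^ (L + 1)) := by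
  have ht : ‖t‖ < 1 := by rwa [Real.norm_of_nonneg h0]
  have hle : ∀ k : ℕ, ((k : ℝ) + 1) ^ L * t ^ k ≤
      L.factorial * (((k + L).choose L : ℝ) * t ^ k) := fun k => by
    rw [← mul_assoc]
    gcongr
    have := Nat.pow_succ_le_ascFactorial (k + 1) L
    rw [Nat.ascFactorial_eq_factorial_mul_choose] at this
    exact_mod_cast this
  have hs := (summable_choose_mul_geometric_of_norm_lt_one L ht).mul_left (L.factorial : ℝ)
  have hs' := hs.of_nonneg_of_le (fun k => by positivity) hle
  refine ⟨hs', (hs'.tsum_le_tsum hle hs).trans (le_of_eq ?_)⟩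
  rw [tsum_mul_left, tsum_choose_mul_geometric_of_norm_lt_one L ht]

lemma TailBound.lintegral_max_rpow_le {s b C v : ℝ} (hs : 0 < s) (hsb : s < b) (hC : 0 ≤ C)
    (hv : 0 < v) {ν : Measure ℝ} (hν : TailBound s C ν) :
    ∫⁻ t in Ico 0 1, ENNReal.ofReal (max (1 - t) v ^ (-b)) ∂ν ≤
      ENNReal.ofReal (C * 2 ^ (s + 1) * ((1 / s + 1 / (b - s)) * v ^ (s - b))) := by
  have hmono : MonotoneOn (fun t => ENNReal.ofReal (max (1 - t) v ^ (-b))) (Ico 0 1) := by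
    intro x hx y hy hxy
    refine ENNReal.ofReal_le_ofReal (Real.rpow_le_rpow_of_nonpos (lt_max_of_lt_right hv) ?_
      (by linarith))
    exact max_le_max (by linarith) le_rfl
  refine (hν.lintegral_monotone_le hs.le hC (by fun_prop) hmono).trans ?_
  rw [ENNReal.ofReal_mul (q := _ * v ^ (s - b)) (by positivity)]
  refine mul_le_mul' le_rfl (le_trans ?_ (lintegral_Ioi_rpow_mul_max_rpow_le hs hsb hv))
  refine le_trans (setLIntegral_mono' measurableSet_Ioo fun u hu => ?_)
    (lintegral_mono_set Ioo_subset_Ioi_self)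
  rw [sub_sub_cancel, ENNReal.ofReal_mul (Real.rpow_nonneg hu.1.le _)]

section
variable {α C : ℝ} {μ : Measure ℝ} {f : ℂ → ℂ}

/-- The Taylor polynomials of `f`. -/
noncomputable def taylorPoly (f : ℂ → ℂ) (N : ℕ) (z : ℂ) : ℂ :=
  ∑ k ∈ Finset.range N, taylorCoeff f k * z ^ k

/-- On this interval the polynomial is at most ∑|a_k|, and the mass is at most C(N + 1)^(-(α + 2)).
Since k ≤ N, the product is at most C times the Cesàro mean of |a_k|(k + 1)^(-(α + 1)). -/
lemma tendsto_lintegral_taylorPoly_near_one (hα : -1 < α) (hC : 0 ≤ C)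
    (hμ : TailBound (α + 2) C μ)
    (ha : Tendsto (fun k : ℕ => ‖taylorCoeff f k‖ * ((k : ℝ) + 1) ^ (-(α + 1))) atTop (𝓝 0)) :
    Tendsto (fun N : ℕ => ∫⁻ t in Ico (1 - 1 / ((N : ℝ) + 1)) 1, ‖taylorPoly f (N + 1) t‖ₑ ∂μ) atTop
      (𝓝 0) := by
  have hces := ((ha.cesaro).comp (tendsto_add_atTop_nat 1)).const_mul C
  rw [mul_zero] at hces
  have hlim := ENNReal.tendsto_ofReal hces
  rw [ENNReal.ofReal_zero] at hlim
  refine tendsto_of_tendsto_of_tendsto_of_le_of_le tendsto_const_nhds hlim (fun _ => zero_le)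
    fun N => ?_
  set v : ℝ := 1 / ((N : ℝ) + 1) with hv
  have hv0 : 0 < v := by positivity
  have hv1 : v ≤ 1 := by
    rw [hv, div_le_one (by positivity)]
    linarith [Nat.cast_nonneg (α := ℝ) N]
  set M := ∑ k ∈ Finset.range (N + 1), ‖taylorCoeff f k‖ with hM
  have hM0 : 0 ≤ M := Finset.sum_nonneg fun _ _ => norm_nonneg _
  have hM' : M * v ^ (α + 1) ≤ ∑ k ∈ Finset.range (N + 1),
      ‖taylorCoeff f k‖ * ((k : ℝ) + 1) ^ (-(α + 1)) := by
    rw [hM, Finset.sum_mul]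
    refine Finset.sum_le_sum fun k hk => mul_le_mul_of_nonneg_left ?_ (norm_nonneg _)
    have hkN : (k : ℝ) ≤ N := by exact_mod_cast Nat.lt_succ_iff.1 (Finset.mem_range.1 hk)
    rw [hv, one_div, Real.inv_rpow (by positivity), ← Real.rpow_neg (by positivity)]
    exact Real.rpow_le_rpow_of_nonpos (by positivity) (by linarith) (by linarith)
  calc ∫⁻ t in Ico (1 - v) 1, ‖taylorPoly f (N + 1) t‖ₑ ∂μ
      ≤ ∫⁻ t in Ico (1 - v) 1, ENNReal.ofReal M ∂μ := by
        refine setLIntegral_mono' measurableSet_Ico fun t ht => ?_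
        have ht0 : 0 ≤ t := by linarith [ht.1]
        rw [← ofReal_norm]
        refine ENNReal.ofReal_le_ofReal ((norm_sum_le _ _).trans
          (Finset.sum_le_sum fun k _ => ?_))
        rw [norm_mul, norm_pow, Complex.norm_real, Real.norm_of_nonneg ht0]
        exact mul_le_of_le_one_right (norm_nonneg _) (pow_le_one₀ ht0 ht.2.le)
    _ = ENNReal.ofReal M * μ (Ico (1 - v) 1) := by
        rw [lintegral_const, Measure.restrict_apply_univ]
    _ ≤ ENNReal.ofReal M * ENNReal.ofReal (C * v ^ (α + 2)) := by
        refine mul_le_mul' le_rfl ?_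
        have := hμ (1 - v) ⟨by linarith, by linarith⟩
        rwa [sub_sub_cancel] at this
    _ = ENNReal.ofReal (C * (v * (M * v ^ (α + 1)))) := by
        rw [← ENNReal.ofReal_mul hM0]
        congr 1
        rw [show α + 2 = α + 1 + 1 by ring, Real.rpow_add_one hv0.ne']
        ring
    _ ≤ _ := by
        refine ENNReal.ofReal_le_ofReal (mul_le_mul_of_nonneg_left ?_ hC)
        simp only [Function.comp, Nat.cast_add, Nat.cast_one]
        rw [← one_div, ← hv]
        exact mul_le_mul_of_nonneg_left hM' hv0.le

/-- For k ≥ N and L ≥ α + 1, (k + 1)^(α + 1) ≤ (N + 1)^(α + 1 - L) (k + 1)^L. The smallness in N is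
thus extracted and a series with an integer exponent remains. -/
lemma enorm_taylorPoly_sub_le {ε : ℝ} {N L : ℕ} (hε : 0 ≤ ε) (hL : α + 1 ≤ L)
    (hf : DifferentiableOn ℂ f (Metric.ball 0 1))
    (hN : ∀ k ≥ N, ‖taylorCoeff f k‖ * ((k : ℝ) + 1) ^ (-(α + 1)) ≤ ε) {t : ℝ}
    (ht : t ∈ Ico (0 : ℝ) 1) :
    ‖taylorPoly f N t - f t‖ₑ ≤ ENNReal.ofReal (ε * L.factorial *
      ((N : ℝ) + 1) ^ (α + 1 - L) * (1 - t) ^ (-((L : ℝ) + 1))) := by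
  have ht1 : 0 < 1 - t := by linarith [ht.2]
  have ht0 := ht.1
  have htb : (t : ℂ) ∈ Metric.ball (0 : ℂ) 1 := by
    simpa [abs_of_nonneg ht.1] using ht.2
  have hsum := hasSum_taylorCoeff hf htb
  obtain ⟨hs, hsle⟩ := tsum_add_one_pow_mul_pow_le L ht.1 ht.2
  have htail : f t - taylorPoly f N t = ∑' k : ℕ, taylorCoeff f (k + N) * (t : ℂ) ^ (k + N) := by
    rw [taylorPoly, ← hsum.tsum_eq, ← hsum.summable.sum_add_tsum_nat_add N, add_sub_cancel_left]
  set D := ε * ((N : ℝ) + 1) ^ (α + 1 - L) with hD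
  have hD0 : 0 ≤ D := by positivity
  have hterm : ∀ k : ℕ, ‖taylorCoeff f (k + N) * (t : ℂ) ^ (k + N)‖ ≤
      D * ((((k + N : ℕ) : ℝ) + 1) ^ L * t ^ (k + N)) := fun k => by
    have h1 := hN (k + N) (by omega)
    set m : ℝ := ((k + N : ℕ) : ℝ) + 1 with hm
    have hm0 : 0 < m := by positivity
    have hNm : (N : ℝ) + 1 ≤ m := by rw [hm]; push_cast; linarith [Nat.cast_nonneg (α := ℝ) k]
    rw [norm_mul, norm_pow, Complex.norm_real, Real.norm_of_nonneg ht.1, ← mul_assoc]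
    refine mul_le_mul_of_nonneg_right ?_ (by positivity)
    rw [Real.rpow_neg hm0.le, ← div_eq_mul_inv, div_le_iff₀ (by positivity)] at h1
    refine h1.trans ?_
    rw [hD, mul_assoc]
    refine mul_le_mul_of_nonneg_left ?_ hε
    calc m ^ (α + 1) = m ^ (α + 1 - L) * m ^ L := by
          rw [← Real.rpow_natCast m L, ← Real.rpow_add hm0, sub_add_cancel]
      _ ≤ _ := by
          refine mul_le_mul_of_nonneg_right ?_ (by positivity)
          exact Real.rpow_le_rpow_of_nonpos (by positivity) hNm (by linarith)
  have hs2 := ((summable_nat_add_iff N).2 hs).mul_left D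
  have hbound : ‖f t - taylorPoly f N t‖ ≤ D * (L.factorial * (1 / (1 - t) ^ (L + 1))) := by
    rw [htail]
    refine (tsum_of_norm_bounded hs2.hasSum hterm).trans ?_
    rw [tsum_mul_left]
    refine mul_le_mul_of_nonneg_left (le_trans ?_ hsle) hD0
    rw [← hs.sum_add_tsum_nat_add N]
    exact le_add_of_nonneg_left (Finset.sum_nonneg fun k _ => by positivity)
  rw [← ofReal_norm, norm_sub_rev]
  refine ENNReal.ofReal_le_ofReal (hbound.trans (le_of_eq ?_))
  rw [hD, Real.rpow_neg ht1.le, one_div]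
  norm_cast
  ring

/-- With v = 1/(N + 1), the integral of (1 - t)^(-(L + 1)) over 1 - t ≥ v is O(v^(α + 1 - L)),
because L > α + 1. This cancels the factor (N + 1)^(α + 1 - L) of the remainder and leaves a
multiple of ε. -/
lemma tendsto_lintegral_taylorPoly_sub_away (hα : -1 < α) (hC : 0 ≤ C)
    (hμ : TailBound (α + 2) C μ) (hf : DifferentiableOn ℂ f (Metric.ball 0 1))
    (ha : Tendsto (fun k : ℕ => ‖taylorCoeff f k‖ * ((k : ℝ) + 1) ^ (-(α + 1))) atTop (𝓝 0)) :
    Tendsto (fun N : ℕ => ∫⁻ t in Ico 0 (1 - 1 / ((N : ℝ) + 1)),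
      ‖taylorPoly f (N + 1) t - f t‖ₑ ∂μ) atTop (𝓝 0) := by
  obtain ⟨L, hL⟩ := exists_nat_gt (α + 1)
  set D : ℝ := L.factorial * (C * 2 ^ (α + 2 + 1) * (1 / (α + 2) + 1 / ((L : ℝ) + 1 - (α + 2))))
    with hD
  have hD0 : 0 < D + 1 := by
    have h1 : 0 < α + 2 := by linarith
    have h2 : 0 < (L : ℝ) + 1 - (α + 2) := by linarith
    positivity
  rw [ENNReal.tendsto_nhds_zero]
  intro δ hδ
  obtain ⟨δ', hδ', hδδ⟩ : ∃ δ' : ℝ, 0 < δ' ∧ ENNReal.ofReal δ' ≤ δ := by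
    rcases eq_or_ne δ ∞ with rfl | h
    · exact ⟨1, one_pos, le_top⟩
    · exact ⟨δ.toReal, ENNReal.toReal_pos hδ.ne' h, (ENNReal.ofReal_toReal h).le⟩
  -- D + 1 rather than D, which vanishes when C = 0.
  set ε := δ' / (D + 1) with hε
  have hε0 : 0 < ε := by positivity
  obtain ⟨N₀, hN₀⟩ := eventually_atTop.1 (ha.eventually (ge_mem_nhds hε0))
  filter_upwards [eventually_ge_atTop N₀] with N hN
  set v : ℝ := 1 / ((N : ℝ) + 1) with hv
  have hv0 : 0 < v := by positivity
  refine le_trans ?_ hδδ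
  have hmax := hμ.lintegral_max_rpow_le (b := (L : ℝ) + 1) (by linarith) (by linarith) hC hv0
  set E := ε * L.factorial * ((N : ℝ) + 1) ^ (α + 1 - L) with hE
  calc ∫⁻ t in Ico 0 (1 - v), ‖taylorPoly f (N + 1) t - f t‖ₑ ∂μ
      ≤ ∫⁻ t in Ico 0 (1 - v),
          ENNReal.ofReal E * ENNReal.ofReal (max (1 - t) v ^ (-((L : ℝ) + 1))) ∂μ := by
        refine setLIntegral_mono' measurableSet_Ico fun t ht => ?_
        rw [← ENNReal.ofReal_mul (by positivity), max_eq_left (by linarith [ht.2])]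
        refine (enorm_taylorPoly_sub_le hε0.le hL.le hf (fun k hk => hN₀ k (by omega))
          ⟨ht.1, by linarith [ht.2]⟩).trans (ENNReal.ofReal_le_ofReal ?_)
        have : 0 ≤ (1 - t) ^ (-((L : ℝ) + 1)) := Real.rpow_nonneg (by linarith [ht.2]) _
        refine mul_le_mul_of_nonneg_right ?_ this
        refine mul_le_mul_of_nonneg_left ?_ (by positivity)
        refine Real.rpow_le_rpow_of_nonpos (by positivity) ?_ (by linarith)
        push_cast
        linarith
    _ ≤ ∫⁻ t in Ico 0 1,
          ENNReal.ofReal E * ENNReal.ofReal (max (1 - t) v ^ (-((L : ℝ) + 1))) ∂μ :=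
        lintegral_mono_set (Ico_subset_Ico_right (by linarith))
    _ ≤ ENNReal.ofReal E * ENNReal.ofReal (C * 2 ^ (α + 2 + 1) *
          ((1 / (α + 2) + 1 / ((L : ℝ) + 1 - (α + 2))) * v ^ (α + 2 - ((L : ℝ) + 1)))) := by
        rw [lintegral_const_mul' _ _ ENNReal.ofReal_ne_top]
        exact mul_le_mul' le_rfl hmax
    _ = ENNReal.ofReal (ε * D) := by
        rw [← ENNReal.ofReal_mul (by positivity)]
        congr 1
        have hvv : ((N : ℝ) + 1) ^ (α + 1 - L) * v ^ (α + 2 - ((L : ℝ) + 1)) = 1 := by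
          rw [show α + 2 - ((L : ℝ) + 1) = α + 1 - L by ring, ← Real.mul_rpow (by positivity)
            hv0.le, hv, mul_one_div_cancel (by positivity), Real.one_rpow]
        calc _ = ε * D * (((N : ℝ) + 1) ^ (α + 1 - L) * v ^ (α + 2 - ((L : ℝ) + 1))) := by
              rw [hE, hD]
              ring
          _ = _ := by rw [hvv, mul_one]
    _ ≤ ENNReal.ofReal δ' := by
        refine ENNReal.ofReal_le_ofReal ?_
        rw [hε, div_mul_eq_mul_div, div_le_iff₀ hD0]
        nlinarith

/-- Near 1 the polynomial and f are estimated separately, f by dominated convergence from the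
Carleson embedding; away from 1 their difference is small. -/
lemma tendsto_lintegral_taylorPoly_sub (hα : -1 < α) (hC : 0 ≤ C)
    (hμ : TailBound (α + 2) C μ) (hf : DifferentiableOn ℂ f (Metric.ball 0 1))
    (hfin : ∫⁻ z, ‖f z‖ₑ ∂diskMeasure α ≠ ∞) :
    Tendsto (fun N : ℕ => ∫⁻ t in Ico (0 : ℝ) 1, ‖taylorPoly f N t - f t‖ₑ ∂μ) atTop (𝓝 0) := by
  have ha := tendsto_norm_taylorCoeff_mul_rpow hα hf hfin
  have hcont : ContinuousOn (fun t : ℝ => f t) (Ico 0 1) :=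
    hf.continuousOn.comp Complex.continuous_ofReal.continuousOn fun t ht => by
      simpa [abs_of_nonneg ht.1] using ht.2
  have hfm : AEMeasurable (fun t : ℝ => ‖f t‖ₑ) (μ.restrict (Ico 0 1)) :=
    (hcont.aestronglyMeasurable measurableSet_Ico).enorm
  have hint : ∫⁻ t in Ico (0 : ℝ) 1, ‖f t‖ₑ ∂μ ≠ ∞ := by
    have := hμ.lintegral_enorm_rpow_le (by linarith) le_rfl hC hf
    simp only [ENNReal.rpow_one] at this
    exact (this.trans_lt (ENNReal.mul_lt_top ENNReal.ofReal_lt_top hfin.lt_top)).ne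
  have hv : Tendsto (fun N : ℕ => 1 - 1 / ((N : ℝ) + 1)) atTop (𝓝 1) := by
    simpa using (tendsto_one_div_add_atTop_nhds_zero_nat (𝕜 := ℝ)).const_sub 1
  have hlim : Tendsto (fun N : ℕ => ∫⁻ t in Ico (0 : ℝ) 1,
      (Ici (1 - 1 / ((N : ℝ) + 1))).indicator (fun t : ℝ => ‖f t‖ₑ) t ∂μ) atTop
      (𝓝 (∫⁻ _ in Ico (0 : ℝ) 1, 0 ∂μ)) := by
    refine tendsto_lintegral_of_dominated_convergence' (fun t : ℝ => ‖f t‖ₑ)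
      (fun k => hfm.indicator measurableSet_Ici) (fun k => ?_) hint ?_
    · exact ae_of_all _ fun z => indicator_le_self _ _ z
    · filter_upwards [ae_restrict_mem measurableSet_Ico] with t ht
      refine tendsto_const_nhds.congr' ?_
      filter_upwards [hv.eventually (lt_mem_nhds ht.2)] with k hk
      rw [indicator_of_notMem]
      exact not_le.2 hk
  rw [lintegral_zero] at hlim
  have hsum := ((tendsto_lintegral_taylorPoly_near_one hα hC hμ ha).add hlim).add
    (tendsto_lintegral_taylorPoly_sub_away hα hC hμ hf ha)
  rw [add_zero, add_zero] at hsum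
  rw [← tendsto_add_atTop_iff_nat 1]
  refine tendsto_of_tendsto_of_tendsto_of_le_of_le tendsto_const_nhds hsum (fun _ => zero_le)
    fun N => ?_
  have hN1 : 1 / ((N : ℝ) + 1) ≤ 1 := by
    rw [div_le_one (by positivity)]
    linarith [Nat.cast_nonneg (α := ℝ) N]
  set v : ℝ := 1 - 1 / ((N : ℝ) + 1) with hv
  have hv0 : 0 ≤ v := by rw [hv]; linarith
  have hv1 : v ≤ 1 := by rw [hv]; linarith [show 0 ≤ 1 / ((N : ℝ) + 1) by positivity]
  have hIci : ∫⁻ t in Ico (0 : ℝ) 1, (Ici v).indicator (fun t : ℝ => ‖f t‖ₑ) t ∂μ =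
      ∫⁻ t in Ico v 1, ‖f t‖ₑ ∂μ := by
    rw [lintegral_indicator measurableSet_Ici, Measure.restrict_restrict measurableSet_Ici]
    congr 2
    ext t
    simp only [mem_inter_iff, mem_Ici, mem_Ico]
    constructor
    · exact fun h => ⟨h.1, h.2.2⟩
    · exact fun h => ⟨h.1, hv0.trans h.1, h.2⟩
  have hpoly : Measurable fun t : ℝ => ‖taylorPoly f (N + 1) t‖ₑ := by
    unfold taylorPoly
    fun_prop
  rw [hIci, ← lintegral_add_left hpoly, ← Ico_union_Ico_eq_Ico hv0 hv1, union_comm]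
  refine (lintegral_union_le _ _ _).trans (add_le_add (lintegral_mono fun t => ?_) le_rfl)
  exact enorm_sub_le

end

/-! ### The integral representation of the operator -/

/-- The `n`-th Taylor coefficient `Γ(n + β) / (n! Γ(β))` of `(1 - z) ^ (-β)`. -/
noncomputable def gammaCoeff (β : ℝ) (n : ℕ) : ℝ :=
  Real.Gamma (n + β) / (n.factorial * Real.Gamma β)

lemma gammaCoeff_nonneg {β : ℝ} (hβ : 0 < β) (n : ℕ) : 0 ≤ gammaCoeff β n :=
  div_nonneg (Real.Gamma_pos_of_pos (by positivity)).le
    (mul_nonneg (by positivity) (Real.Gamma_pos_of_pos hβ).le)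

lemma choose_eq_gammaCoeff {β : ℝ} (hβ : 0 < β) (n : ℕ) :
    Ring.choose ((β : ℂ) + n - 1) n = gammaCoeff β n := by
  have h1 := Ring.factorial_nsmul_multichoose_eq_ascPochhammer (β : ℂ) n
  rw [Polynomial.ascPochhammer_smeval_eq_eval, Ring.multichoose_eq, nsmul_eq_mul,
    ← Complex.Gamma_add_nat_div_Gamma_eq] at h1
  · have h2 : (n.factorial : ℂ) ≠ 0 := by exact_mod_cast n.factorial_ne_zero
    have h3 : (Real.Gamma β : ℂ) ≠ 0 := by exact_mod_cast (Real.Gamma_pos_of_pos hβ).ne'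
    have h4 : ((β : ℂ) + n) = ((n + β : ℝ) : ℂ) := by push_cast; ring
    rw [h4, Complex.Gamma_ofReal, Complex.Gamma_ofReal] at h1
    rw [gammaCoeff]
    push_cast at h1 ⊢
    rw [add_comm (n : ℂ)] at h1
    field_simp at h1 ⊢
    rw [← h1]
  · intro k hk
    have := congrArg Complex.re hk
    simp only [Complex.ofReal_re, Complex.neg_re, Complex.natCast_re] at this
    linarith [Nat.cast_nonneg (α := ℝ) k]

lemma hasSum_gammaCoeff {β : ℝ} (hβ : 0 < β) {w : ℂ} (hw : ‖w‖ < 1) :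
    HasSum (fun n => (gammaCoeff β n : ℂ) * w ^ n) ((1 - w) ^ (-(β : ℂ))) := by
  have h := (Complex.one_div_one_sub_cpow_hasFPowerSeriesOnBall_zero (β : ℂ)).hasSum (y := w)
    (by simpa [Metric.mem_eball, edist_zero_right, ← ofReal_norm] using hw)
  simp only [FormalMultilinearSeries.ofScalars_apply_eq, zero_add, smul_eq_mul,
    choose_eq_gammaCoeff hβ] at h
  rwa [one_div, ← Complex.cpow_neg] at h

lemma summable_gammaCoeff {β : ℝ} (hβ : 0 < β) {r : ℝ} (h0 : 0 ≤ r) (hr : r < 1) :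
    Summable fun n => gammaCoeff β n * r ^ n := by
  have := (hasSum_gammaCoeff hβ (w := r) (by simpa [abs_of_nonneg h0] using hr)).summable
  exact_mod_cast this

lemma diskMeasure_univ_lt_top {α : ℝ} (hα : -1 < α) : diskMeasure α univ < ∞ := by
  obtain ⟨C, -, hC⟩ := exists_lintegral_ball_norm_one_sub_rpow_le (b := α + 3) hα (by linarith)
  have h0 := hC 0 ⟨le_rfl, one_pos⟩
  simp only [Complex.ofReal_zero, zero_mul, sub_zero, norm_one, Real.one_rpow, mul_one] at h0
  have h1 := lintegral_diskMeasure_le α fun _ => 1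
  simp only [lintegral_const, one_mul] at h1
  exact h1.trans_lt (ENNReal.mul_lt_top ENNReal.ofReal_lt_top
    (h0.trans_lt ENNReal.ofReal_lt_top))

lemma lintegral_enorm_ne_top_of_mem_bergmanSpace {α p : ℝ} (hα : -1 < α) (hp : 1 ≤ p) {f : ℂ → ℂ}
    (hf : f ∈ bergmanSpace p α) : ∫⁻ z, ‖f z‖ₑ ∂diskMeasure α ≠ ∞ := by
  have h1 := (bergmanNorm_lt_top_iff (by linarith) hα f).1 hf.2
  refine ((lintegral_mono (g := fun z => 1 + ‖f z‖ₑ ^ p) fun z => ?_).trans_lt ?_).ne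
  · rcases le_total ‖f z‖ₑ 1 with h | h
    · exact h.trans le_self_add
    · calc ‖f z‖ₑ = ‖f z‖ₑ ^ (1 : ℝ) := (ENNReal.rpow_one _).symm
        _ ≤ ‖f z‖ₑ ^ p := ENNReal.rpow_le_rpow_of_exponent_le h hp
        _ ≤ _ := le_add_self
  · rw [lintegral_add_left measurable_const, lintegral_const, one_mul]
    exact ENNReal.add_lt_top.2 ⟨diskMeasure_univ_lt_top hα, h1⟩

/-- The assumptions under which the integral representation of `H_{μ,β} f` holds: the measure is
finite on `[0, 1)`, `f` is analytic and `μ`-integrable, and its Taylor polynomials converge to it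
in `L¹(μ)`. -/
structure TaylorConverges (μ : Measure ℝ) (f : ℂ → ℂ) : Prop where
  measure_ne_top : μ (Ico 0 1) ≠ ∞
  differentiableOn : DifferentiableOn ℂ f (Metric.ball 0 1)
  lintegral_ne_top : ∫⁻ t in Ico (0 : ℝ) 1, ‖f t‖ₑ ∂μ ≠ ∞
  tendsto : Tendsto (fun N : ℕ => ∫⁻ t in Ico (0 : ℝ) 1, ‖taylorPoly f N t - f t‖ₑ ∂μ) atTop (𝓝 0)

namespace TaylorConverges
variable {μ : Measure ℝ} {f : ℂ → ℂ}

lemma aestronglyMeasurable (h : TaylorConverges μ f) :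
    AEStronglyMeasurable (fun t : ℝ => f t) (μ.restrict (Ico 0 1)) := by
  have hcont : ContinuousOn (fun t : ℝ => f t) (Ico 0 1) :=
    h.differentiableOn.continuousOn.comp Complex.continuous_ofReal.continuousOn fun t ht => by
      simpa [abs_of_nonneg ht.1] using ht.2
  exact hcont.aestronglyMeasurable measurableSet_Ico

lemma integrable (h : TaylorConverges μ f) :
    Integrable (fun t : ℝ => f t) (μ.restrict (Ico 0 1)) :=
  ⟨h.aestronglyMeasurable, h.lintegral_ne_top.lt_top⟩

lemma isFiniteMeasure (h : TaylorConverges μ f) : IsFiniteMeasure (μ.restrict (Ico 0 1)) :=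
  ⟨by simpa using h.measure_ne_top.lt_top⟩

lemma integrable_pow (h : TaylorConverges μ f) (m : ℕ) :
    Integrable (fun t : ℝ => t ^ m) (μ.restrict (Ico 0 1)) := by
  have := h.isFiniteMeasure
  refine Integrable.of_bound (by fun_prop) 1 ?_
  filter_upwards [ae_restrict_mem measurableSet_Ico] with t ht
  rw [norm_pow, Real.norm_of_nonneg ht.1]
  exact pow_le_one₀ ht.1 ht.2.le

lemma integrable_pow_mul (h : TaylorConverges μ f) (n : ℕ) :
    Integrable (fun t : ℝ => (t : ℂ) ^ n * f t) (μ.restrict (Ico 0 1)) := by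
  refine h.integrable.norm.mono' ?_ ?_
  · exact AEStronglyMeasurable.mul (by fun_prop) h.aestronglyMeasurable
  · filter_upwards [ae_restrict_mem measurableSet_Ico] with t ht
    rw [norm_mul, norm_pow, Complex.norm_real, Real.norm_of_nonneg ht.1]
    exact mul_le_of_le_one_left (norm_nonneg _) (pow_le_one₀ ht.1 ht.2.le)

lemma hankelPartialSum_eq (h : TaylorConverges μ f) (β : ℝ) (n N : ℕ) :
    hankelPartialSum μ β f n N =
      gammaCoeff β n * ∫ t in Ico (0 : ℝ) 1, (t : ℂ) ^ n * taylorPoly f N t ∂μ := by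
  have h1 : ∀ k, Integrable (fun t : ℝ => (t : ℂ) ^ (n + k) * taylorCoeff f k)
      (μ.restrict (Ico 0 1)) := fun k => by
    have := (h.integrable_pow (n + k)).ofReal (𝕜 := ℂ)
    simpa using this.mul_const (taylorCoeff f k)
  have h2 : ∀ t : ℝ, (t : ℂ) ^ n * taylorPoly f N t =
      ∑ k ∈ Finset.range N, (t : ℂ) ^ (n + k) * taylorCoeff f k := fun t => by
    rw [taylorPoly, Finset.mul_sum]
    refine Finset.sum_congr rfl fun k _ => ?_
    ring
  simp only [h2]
  rw [integral_finsetSum _ fun k _ => h1 k, Finset.mul_sum, hankelPartialSum]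
  refine Finset.sum_congr rfl fun k _ => ?_
  rw [hankelEntry, integral_const_mul, integral_mul_const]
  push_cast
  rw [← integral_complex_ofReal]
  simp only [gammaCoeff, Complex.ofReal_pow]
  push_cast
  ring

lemma tendsto_hankelPartialSum (h : TaylorConverges μ f) (β : ℝ) (n : ℕ) :
    Tendsto (hankelPartialSum μ β f n) atTop
      (𝓝 (gammaCoeff β n * ∫ t in Ico (0 : ℝ) 1, (t : ℂ) ^ n * f t ∂μ)) := by
  have := h.isFiniteMeasure
  rw [show hankelPartialSum μ β f n = fun N => _ from funext (h.hankelPartialSum_eq β n)]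
  refine Tendsto.const_mul _ (tendsto_integral_of_L1 _ (h.integrable_pow_mul n).1 ?_ ?_)
  · refine Eventually.of_forall fun N => ?_
    have h2 : Continuous fun t : ℝ => (t : ℂ) ^ n * taylorPoly f N t := by
      unfold taylorPoly
      fun_prop
    have h3 : IntegrableOn (fun t : ℝ => (t : ℂ) ^ n * taylorPoly f N t) (Ico 0 1) μ := by
      obtain ⟨B, hB⟩ := isCompact_Icc.exists_bound_of_continuousOn (s := Icc (0 : ℝ) 1)
        h2.continuousOn
      refine Integrable.of_bound h2.aestronglyMeasurable B ?_
      filter_upwards [ae_restrict_mem measurableSet_Ico] with t ht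
      exact hB t ⟨ht.1, ht.2.le⟩
    exact h3
  · refine tendsto_of_tendsto_of_tendsto_of_le_of_le tendsto_const_nhds h.tendsto
      (fun _ => zero_le) fun N => setLIntegral_mono' measurableSet_Ico fun t ht => ?_
    rw [← mul_sub, enorm_mul]
    refine mul_le_of_le_one_left' ?_
    rw [← ofReal_norm, norm_pow, Complex.norm_real, Real.norm_of_nonneg ht.1,
      ENNReal.ofReal_le_one]
    exact pow_le_one₀ ht.1 ht.2.le

lemma hankelCoeff_eq (h : TaylorConverges μ f) (β : ℝ) (n : ℕ) :
    hankelCoeff μ β f n = gammaCoeff β n * ∫ t in Ico (0 : ℝ) 1, (t : ℂ) ^ n * f t ∂μ :=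
  (h.tendsto_hankelPartialSum β n).limUnder_eq

/-- Sum and integral may be exchanged since |t^n f(t)| ≤ |f(t)| is integrable and the binomial
series converges absolutely at |z|. -/
lemma hasSum_hankelCoeff (h : TaylorConverges μ f) {β : ℝ} (hβ : 0 < β) {z : ℂ} (hz : ‖z‖ < 1) :
    HasSum (fun n => hankelCoeff μ β f n * z ^ n)
      (∫ t in Ico (0 : ℝ) 1, f t * (1 - t * z) ^ (-(β : ℂ)) ∂μ) := by
  set F : ℕ → ℝ → ℂ := fun n t => (gammaCoeff β n * z ^ n) * ((t : ℂ) ^ n * f t) with hF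
  have hint : ∀ n, Integrable (F n) (μ.restrict (Ico 0 1)) := fun n =>
    (h.integrable_pow_mul n).const_mul _
  have hsum : Summable fun n => ∫ t in Ico (0 : ℝ) 1, ‖F n t‖ ∂μ := by
    refine Summable.of_nonneg_of_le (fun n => integral_nonneg fun t => norm_nonneg _) (fun n => ?_)
      ((summable_gammaCoeff hβ (norm_nonneg z) hz).mul_right (∫ t in Ico (0 : ℝ) 1, ‖f t‖ ∂μ))
    rw [← integral_const_mul]
    refine setIntegral_mono_on (hint n).norm (h.integrable.norm.const_mul _) measurableSet_Ico
      fun t ht => ?_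
    rw [hF, norm_mul, norm_mul, norm_mul, norm_pow, norm_pow, Complex.norm_real, Complex.norm_real,
      Real.norm_of_nonneg ht.1, Real.norm_of_nonneg (gammaCoeff_nonneg hβ n)]
    refine mul_le_mul_of_nonneg_left ?_ (mul_nonneg (gammaCoeff_nonneg hβ n) (by positivity))
    exact mul_le_of_le_one_left (norm_nonneg _) (pow_le_one₀ ht.1 ht.2.le)
  have := hasSum_integral_of_summable_integral_norm hint hsum
  have e1 : (fun n => hankelCoeff μ β f n * z ^ n) = fun n => ∫ t in Ico (0 : ℝ) 1, F n t ∂μ := by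
    funext n
    rw [hF, integral_const_mul, h.hankelCoeff_eq]
    ring
  have e2 : ∫ t in Ico (0 : ℝ) 1, f t * (1 - t * z) ^ (-(β : ℂ)) ∂μ =
      ∫ t in Ico (0 : ℝ) 1, ∑' n, F n t ∂μ := by
    refine setIntegral_congr_fun measurableSet_Ico fun t ht => ?_
    have htz : ‖(t : ℂ) * z‖ < 1 := by
      rw [norm_mul, Complex.norm_real, Real.norm_of_nonneg ht.1]
      nlinarith [ht.1, ht.2, norm_nonneg z]
    rw [← (hasSum_gammaCoeff hβ htz).tsum_eq, ← tsum_mul_left]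
    refine tsum_congr fun n => ?_
    rw [hF, mul_pow]
    ring
  rw [e1, e2]
  exact this

lemma hilbertOp_eq (h : TaylorConverges μ f) {β : ℝ} (hβ : 0 < β) {z : ℂ} (hz : ‖z‖ < 1) :
    hilbertOp μ β f z = ∫ t in Ico (0 : ℝ) 1, f t * (1 - t * z) ^ (-(β : ℂ)) ∂μ :=
  (h.hasSum_hankelCoeff hβ hz).tsum_eq

lemma hilbertOpDefined (h : TaylorConverges μ f) {β : ℝ} (hβ : 0 < β) :
    HilbertOpDefined μ β f :=
  ⟨h.integrable_pow, fun n => ⟨_, h.tendsto_hankelPartialSum β n⟩, fun z hz =>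
    (h.hasSum_hankelCoeff hβ (by simpa using hz)).summable⟩

lemma differentiableOn_hilbertOp (h : TaylorConverges μ f) {β : ℝ} (hβ : 0 < β) :
    DifferentiableOn ℂ (hilbertOp μ β f) (Metric.ball 0 1) := by
  intro z hz
  obtain ⟨r, hzr, hr1⟩ := exists_between (show ‖z‖ < 1 by simpa using hz)
  have hr0 : 0 ≤ r := (norm_nonneg z).trans hzr.le
  have hs : Summable fun n => ‖hankelCoeff μ β f n * (r : ℂ) ^ n‖ :=
    (h.hasSum_hankelCoeff hβ (z := r) (by simpa [abs_of_nonneg hr0] using hr1)).summable.norm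
  have hd := Complex.differentiableOn_tsum_of_summable_norm (U := Metric.ball 0 r)
    (F := fun n w => hankelCoeff μ β f n * w ^ n) hs (fun n => by fun_prop) Metric.isOpen_ball
    fun n w hw => by
      have hw' : ‖w‖ < r := by simpa using hw
      rw [norm_mul, norm_mul, norm_pow, norm_pow, Complex.norm_real, Real.norm_of_nonneg hr0]
      gcongr
  exact (hd.differentiableAt (Metric.isOpen_ball.mem_nhds (by simpa using hzr))).differentiableWithinAt

lemma of_tailBound {α p C : ℝ} (hα : -1 < α) (hp : 1 ≤ p) (hC : 0 ≤ C)
    (hμ : TailBound (α + 2) C μ) (hf : f ∈ bergmanSpace p α) : TaylorConverges μ f := by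
  have hfin := lintegral_enorm_ne_top_of_mem_bergmanSpace hα hp hf
  have hint := hμ.lintegral_enorm_rpow_le (by linarith) le_rfl hC hf.1
  simp only [ENNReal.rpow_one] at hint
  exact ⟨hμ.ne_top, hf.1,
    (hint.trans_lt (ENNReal.mul_lt_top ENNReal.ofReal_lt_top hfin.lt_top)).ne,
    tendsto_lintegral_taylorPoly_sub hα hC hμ hf.1 hfin⟩

/-- Serves the necessity part, where only finiteness of μ is available: a function analytic beyond
the closed disc has absolutely summable coefficients. -/
lemma of_differentiableOn {R : ℝ} (hμ : μ (Ico 0 1) ≠ ∞) (hR : 1 < R)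
    (hf : DifferentiableOn ℂ f (Metric.ball 0 R)) : TaylorConverges μ f := by
  have hone : (1 : ℂ) ∈ Metric.ball (0 : ℂ) R := by simpa using hR
  have hs : Summable fun k => ‖taylorCoeff f k‖ := by
    simpa using (hasSum_taylorCoeff hf hone).summable.norm
  have hnorm : ∀ t ∈ Ico (0 : ℝ) 1, ∀ k, ‖taylorCoeff f k * (t : ℂ) ^ k‖ ≤ ‖taylorCoeff f k‖ :=
    fun t ht k => by
      rw [norm_mul, norm_pow, Complex.norm_real, Real.norm_of_nonneg ht.1]
      exact mul_le_of_le_one_right (norm_nonneg _) (pow_le_one₀ ht.1 ht.2.le)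
  have hsum : ∀ t ∈ Ico (0 : ℝ) 1, HasSum (fun k => taylorCoeff f k * (t : ℂ) ^ k) (f t) :=
    fun t ht => hasSum_taylorCoeff hf (by simpa [abs_of_nonneg ht.1] using ht.2.trans hR)
  refine ⟨hμ, hf.mono (Metric.ball_subset_ball hR.le), ?_, ?_⟩
  · refine ((setLIntegral_mono' (g := fun _ => ENNReal.ofReal (∑' k, ‖taylorCoeff f k‖))
      measurableSet_Ico fun t ht => ?_).trans_lt ?_).ne
    · rw [← ofReal_norm, ← (hsum t ht).tsum_eq]
      exact ENNReal.ofReal_le_ofReal (tsum_of_norm_bounded hs.hasSum (hnorm t ht))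
    · rw [lintegral_const, Measure.restrict_apply_univ]
      exact ENNReal.mul_lt_top ENNReal.ofReal_lt_top hμ.lt_top
  · have hlim := ENNReal.Tendsto.mul_const (b := μ (Ico 0 1)) (ENNReal.tendsto_ofReal
      (tendsto_sum_nat_add fun k => ‖taylorCoeff f k‖)) (Or.inr hμ)
    rw [ENNReal.ofReal_zero, zero_mul] at hlim
    refine tendsto_of_tendsto_of_tendsto_of_le_of_le tendsto_const_nhds hlim (fun _ => zero_le)
      fun N => (setLIntegral_mono' (g := fun _ => ENNReal.ofReal
        (∑' k, ‖taylorCoeff f (k + N)‖)) measurableSet_Ico fun t ht => ?_).trans ?_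
    · rw [← ofReal_norm, norm_sub_rev, taylorPoly, ← (hsum t ht).tsum_eq,
        ← (hsum t ht).summable.sum_add_tsum_nat_add N, add_sub_cancel_left]
      exact ENNReal.ofReal_le_ofReal (tsum_of_norm_bounded ((summable_nat_add_iff N).2 hs).hasSum
        fun k => hnorm t ht (k + N))
    · rw [lintegral_const, Measure.restrict_apply_univ]

end TaylorConverges

/-! ### Sufficiency for p > 1 -/

/-- Schur's test. -/
lemma lintegral_rpow_lintegral_le_of_schur {X Y : Type*} [MeasurableSpace X] [MeasurableSpace Y]
    {ν : Measure X} {μ : Measure Y} [SFinite ν] [SFinite μ] {p q : ℝ} (hpq : p.HolderConjugate q)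
    {k : X → Y → ℝ≥0∞} (hk : Measurable (Function.uncurry k)) {a : Y → ℝ≥0∞} (ha : Measurable a)
    (ha0 : ∀ᵐ y ∂μ, a y ≠ 0 ∧ a y ≠ ∞) {b : X → ℝ≥0∞} (hb : Measurable b) {A B : ℝ≥0∞}
    (h1 : ∀ᵐ x ∂ν, ∫⁻ y, k x y * a y ^ q ∂μ ≤ A * b x ^ q)
    (h2 : ∀ᵐ y ∂μ, ∫⁻ x, k x y * b x ^ p ∂ν ≤ B * a y ^ p)
    {F : Y → ℝ≥0∞} (hF : AEMeasurable F μ) :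
    ∫⁻ x, (∫⁻ y, F y * k x y ∂μ) ^ p ∂ν ≤ A ^ (p / q) * B * ∫⁻ y, F y ^ p ∂μ := by
  have hp := hpq.pos
  have hq := hpq.symm.pos
  have hk1 : ∀ x, Measurable (k x) := fun x => hk.comp measurable_prodMk_left
  have hk2 : ∀ y, Measurable fun x => k x y := fun y => hk.comp measurable_prodMk_right
  have hpt : ∀ᵐ x ∂ν, (∫⁻ y, F y * k x y ∂μ) ^ p ≤
      A ^ (p / q) * ∫⁻ y, k x y * (a y)⁻¹ ^ p * F y ^ p * b x ^ p ∂μ := by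
    filter_upwards [h1] with x hx
    have hkx := hk1 x
    -- The factor a⁻¹ · a is inserted before Hölder's inequality; this needs a to be neither 0 nor ∞
    -- almost everywhere.
    have hsplit : ∫⁻ y, F y * k x y ∂μ =
        ∫⁻ y, ((fun y => k x y ^ (1 / p) * (a y)⁻¹ * F y) * fun y => k x y ^ (1 / q) * a y) y ∂μ := by
      refine lintegral_congr_ae ?_
      filter_upwards [ha0] with y hy
      simp only [Pi.mul_apply]
      have hkk : k x y ^ (1 / p) * k x y ^ (1 / q) = k x y := by
        rw [← ENNReal.rpow_add_of_nonneg _ _ (by positivity) (by positivity), one_div, one_div,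
          hpq.inv_add_inv_eq_one, ENNReal.rpow_one]
      calc F y * k x y = F y * (k x y ^ (1 / p) * k x y ^ (1 / q)) * ((a y)⁻¹ * a y) := by
            rw [hkk, ENNReal.inv_mul_cancel hy.1 hy.2, mul_one]
        _ = _ := by ring
    have hH := ENNReal.lintegral_mul_le_Lp_mul_Lq μ hpq
      (f := fun y => k x y ^ (1 / p) * (a y)⁻¹ * F y) (g := fun y => k x y ^ (1 / q) * a y)
      (by fun_prop) (by fun_prop)
    rw [← hsplit] at hH
    refine (ENNReal.rpow_le_rpow hH hp.le).trans ?_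
    have e1 : ∀ y, (k x y ^ (1 / p) * (a y)⁻¹ * F y) ^ p = k x y * (a y)⁻¹ ^ p * F y ^ p :=
      fun y => by
        rw [ENNReal.mul_rpow_of_nonneg _ _ hp.le, ENNReal.mul_rpow_of_nonneg _ _ hp.le,
          ← ENNReal.rpow_mul, one_div_mul_cancel hp.ne', ENNReal.rpow_one]
    have e2 : ∀ y, (k x y ^ (1 / q) * a y) ^ q = k x y * a y ^ q := fun y => by
      rw [ENNReal.mul_rpow_of_nonneg _ _ hq.le, ← ENNReal.rpow_mul, one_div_mul_cancel hq.ne',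
        ENNReal.rpow_one]
    simp only [e1, e2]
    rw [ENNReal.mul_rpow_of_nonneg _ _ hp.le, ← ENNReal.rpow_mul, one_div_mul_cancel hp.ne',
      ENNReal.rpow_one, ← ENNReal.rpow_mul, one_div_mul_eq_div]
    calc _ ≤ (∫⁻ y, k x y * (a y)⁻¹ ^ p * F y ^ p ∂μ) * (A * b x ^ q) ^ (p / q) := by
          gcongr
      _ = A ^ (p / q) * ((∫⁻ y, k x y * (a y)⁻¹ ^ p * F y ^ p ∂μ) * b x ^ p) := by
          rw [ENNReal.mul_rpow_of_nonneg _ _ (by positivity), ← ENNReal.rpow_mul,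
            mul_div_cancel₀ _ hq.ne']
          ring
      _ = _ := by
          rw [← lintegral_mul_const'' _ (by fun_prop)]
  have hG : AEMeasurable (Function.uncurry fun x y => k x y * (a y)⁻¹ ^ p * F y ^ p * b x ^ p)
      (ν.prod μ) := by
    have hF2 : AEMeasurable (fun z : X × Y => F z.2) (ν.prod μ) := hF.comp_snd
    have hk' : Measurable fun z : X × Y => k z.1 z.2 := hk
    unfold Function.uncurry
    fun_prop
  calc _ ≤ ∫⁻ x, A ^ (p / q) * ∫⁻ y, k x y * (a y)⁻¹ ^ p * F y ^ p * b x ^ p ∂μ ∂ν :=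
        lintegral_mono_ae hpt
    _ = A ^ (p / q) * ∫⁻ x, ∫⁻ y, k x y * (a y)⁻¹ ^ p * F y ^ p * b x ^ p ∂μ ∂ν := by
        exact lintegral_const_mul'' _ hG.lintegral_prod_right'
    _ = A ^ (p / q) * ∫⁻ y, ∫⁻ x, k x y * (a y)⁻¹ ^ p * F y ^ p * b x ^ p ∂ν ∂μ := by
        rw [lintegral_lintegral_swap hG]
    _ ≤ A ^ (p / q) * ∫⁻ y, B * F y ^ p ∂μ := by
        refine mul_le_mul' le_rfl (lintegral_mono_ae ?_)
        filter_upwards [h2, ha0] with y hy hay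
        have hky := hk2 y
        calc ∫⁻ x, k x y * (a y)⁻¹ ^ p * F y ^ p * b x ^ p ∂ν
            = (∫⁻ x, k x y * b x ^ p ∂ν) * ((a y)⁻¹ ^ p * F y ^ p) := by
              rw [← lintegral_mul_const _ (by fun_prop)]
              refine lintegral_congr fun x => ?_
              ring
          _ ≤ B * a y ^ p * ((a y)⁻¹ ^ p * F y ^ p) := by gcongr
          _ = B * F y ^ p * (a y * (a y)⁻¹) ^ p := by
              rw [ENNReal.mul_rpow_of_nonneg _ _ hp.le]
              ring
          _ = B * F y ^ p := by
              rw [ENNReal.mul_inv_cancel hay.1 hay.2, ENNReal.one_rpow, mul_one]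
    _ = _ := by
        rw [lintegral_const_mul'' _ (by fun_prop), mul_assoc]

lemma max_one_sub_le_norm_one_sub_mul {t : ℝ} {z : ℂ} (ht : t ∈ Ico (0 : ℝ) 1) (hz : ‖z‖ < 1) :
    max (1 - t) (1 - ‖z‖) ≤ ‖1 - t * z‖ := by
  have h := norm_sub_norm_le (1 : ℂ) (t * z)
  rw [norm_one, norm_mul, Complex.norm_real, Real.norm_of_nonneg ht.1] at h
  refine (max_le ?_ ?_).trans h <;> nlinarith [ht.1, ht.2, norm_nonneg z]

lemma TaylorConverges.enorm_hilbertOp_le {μ : Measure ℝ} {f : ℂ → ℂ} (h : TaylorConverges μ f)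
    {β : ℝ} (hβ : 0 < β) {z : ℂ} (hz : ‖z‖ < 1) :
    ‖hilbertOp μ β f z‖ₑ ≤
      ∫⁻ t in Ico (0 : ℝ) 1, ‖f t‖ₑ * ENNReal.ofReal (‖1 - t * z‖ ^ (-β)) ∂μ := by
  rw [h.hilbertOp_eq hβ hz]
  refine (enorm_integral_le_lintegral_enorm _).trans (le_of_eq (lintegral_congr fun t => ?_))
  rw [enorm_mul, ← ofReal_norm (_ ^ _), ← Complex.ofReal_neg, Complex.norm_cpow_real]

/-- Replacing |1 - t z| by its lower bound max(1 - t, 1 - |z|) makes the integrand increasing in t,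
so the domination by (1 - t)^(s - 1) dt applies. -/
lemma TailBound.lintegral_kernel_le {s δ C : ℝ} (hδ : 0 < δ) (hδs : δ < s) (hC : 0 ≤ C)
    {μ : Measure ℝ} (hμ : TailBound s C μ) {z : ℂ} (hz : ‖z‖ < 1) :
    ∫⁻ t in Ico (0 : ℝ) 1, ENNReal.ofReal (‖1 - t * z‖ ^ (-s)) * ENNReal.ofReal ((1 - t) ^ (-δ)) ∂μ ≤
      ENNReal.ofReal (C * 2 ^ (s + 1) * (1 / (s - δ) + 1 / δ)) *
        ENNReal.ofReal ((1 - ‖z‖) ^ (-δ)) := by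
  have hs : 0 < s := hδ.trans hδs
  have hv : 0 < 1 - ‖z‖ := by linarith
  set K : ℝ → ℝ≥0∞ := fun t =>
    ENNReal.ofReal (max (1 - t) (1 - ‖z‖) ^ (-s)) * ENNReal.ofReal ((1 - t) ^ (-δ)) with hK
  have hmono : MonotoneOn K (Ico 0 1) := by
    intro x hx y hy hxy
    have hy1 : 0 < 1 - y := by linarith [hy.2]
    refine mul_le_mul' (ENNReal.ofReal_le_ofReal ?_) (ENNReal.ofReal_le_ofReal ?_)
    · exact Real.rpow_le_rpow_of_nonpos (lt_max_of_lt_right hv)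
        (max_le_max (by linarith) le_rfl) (by linarith)
    · exact Real.rpow_le_rpow_of_nonpos hy1 (by linarith) (by linarith)
  calc _ ≤ ∫⁻ t in Ico 0 1, K t ∂μ := by
        refine setLIntegral_mono' measurableSet_Ico fun t ht => ?_
        refine mul_le_mul' (ENNReal.ofReal_le_ofReal ?_) le_rfl
        exact Real.rpow_le_rpow_of_nonpos (lt_max_of_lt_right hv)
          (max_one_sub_le_norm_one_sub_mul ht hz) (by linarith)
    _ ≤ ENNReal.ofReal (C * 2 ^ (s + 1)) *
          ∫⁻ u in Ioo 0 1, ENNReal.ofReal (u ^ (s - 1)) * K (1 - u) :=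
        hμ.lintegral_monotone_le hs.le hC (by fun_prop) hmono
    _ ≤ ENNReal.ofReal (C * 2 ^ (s + 1)) *
          ENNReal.ofReal ((1 / (s - δ) + 1 / (s - (s - δ))) * (1 - ‖z‖) ^ (s - δ - s)) := by
        refine mul_le_mul' le_rfl (le_trans ?_ (lintegral_Ioi_rpow_mul_max_rpow_le
          (a := s - δ) (b := s) (by linarith) (by linarith) hv))
        refine le_trans (setLIntegral_mono' measurableSet_Ioo fun u hu => ?_)
          (lintegral_mono_set Ioo_subset_Ioi_self)
        have hu0 := hu.1
        simp only [hK, sub_sub_cancel]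
        rw [← ENNReal.ofReal_mul (by positivity), ← ENNReal.ofReal_mul (by positivity)]
        refine ENNReal.ofReal_le_ofReal (le_of_eq ?_)
        rw [show s - δ - 1 = s - 1 + -δ by ring, Real.rpow_add hu0]
        ring
    _ = _ := by
        have h3 : 0 < s - δ := by linarith
        rw [← ENNReal.ofReal_mul (by positivity), ← ENNReal.ofReal_mul (by positivity),
          sub_sub_cancel, show s - δ - s = -δ by ring, mul_assoc (C * 2 ^ (s + 1))]

/-- Forelli–Rudin with weight exponent c = α - δ: δ < α + 1 makes the weight integrable, and δ > 0
puts the kernel above the critical exponent c + 2. -/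
lemma exists_lintegral_kernel_diskMeasure_le {α δ : ℝ} (hδ : 0 < δ) (hδα : δ < α + 1) :
    ∃ B : ℝ, 0 < B ∧ ∀ t ∈ Ico (0 : ℝ) 1,
      ∫⁻ z, ENNReal.ofReal (‖1 - t * z‖ ^ (-(α + 2))) * ENNReal.ofReal ((1 - ‖z‖) ^ (-δ))
        ∂diskMeasure α ≤ ENNReal.ofReal B * ENNReal.ofReal ((1 - t) ^ (-δ)) := by
  obtain ⟨C, hC, hle⟩ := exists_lintegral_ball_norm_one_sub_rpow_le (b := α + 2) (c := α - δ)
    (by linarith) (by linarith)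
  refine ⟨2 ^ |α| * C, by positivity, fun t ht => ?_⟩
  refine (lintegral_diskMeasure_le α _).trans ?_
  rw [ENNReal.ofReal_mul (by positivity), mul_assoc]
  refine mul_le_mul' le_rfl ?_
  have h1 := hle t ht
  rw [show α - δ + 2 - (α + 2) = -δ by ring, ENNReal.ofReal_mul hC.le] at h1
  refine le_trans (setLIntegral_mono' measurableSet_ball fun z hz => ?_) h1
  have hz1 : 0 < 1 - ‖z‖ := by
    have : ‖z‖ < 1 := by simpa using hz
    linarith
  rw [← ENNReal.ofReal_mul (by positivity), ← ENNReal.ofReal_mul (by positivity)]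
  refine ENNReal.ofReal_le_ofReal (le_of_eq ?_)
  rw [Real.rpow_sub hz1, Real.rpow_neg hz1.le δ]
  ring

lemma exists_lintegral_kernel_diskMeasure_le_log {α : ℝ} (hα : -1 < α) :
    ∃ B : ℝ, 0 < B ∧ ∀ t ∈ Ico (0 : ℝ) 1,
      ∫⁻ z, ENNReal.ofReal (‖1 - t * z‖ ^ (-(α + 2))) ∂diskMeasure α ≤
        ENNReal.ofReal B * ENNReal.ofReal (1 + Real.log (1 / (1 - t))) := by
  obtain ⟨C, hC, hle⟩ := exists_lintegral_ball_norm_one_sub_rpow_le_log hα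
  refine ⟨2 ^ |α| * C, by positivity, fun t ht => ?_⟩
  refine (lintegral_diskMeasure_le α _).trans ?_
  rw [ENNReal.ofReal_mul (by positivity), mul_assoc]
  refine mul_le_mul' le_rfl ?_
  have h1 := hle t ht
  rw [ENNReal.ofReal_mul hC.le] at h1
  refine le_trans (setLIntegral_mono' measurableSet_ball fun z hz => ?_) h1
  rw [← ENNReal.ofReal_mul (by positivity), mul_comm]

lemma hilbertOpBoundedOn_of_lintegral_le {μ : Measure ℝ} {β p α : ℝ} (hβ : 0 < β) (hp : 1 ≤ p)
    (hα : -1 < α) (hT : ∀ f ∈ bergmanSpace p α, TaylorConverges μ f) {C : ℝ} (hC : 0 ≤ C)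
    (h : ∀ f ∈ bergmanSpace p α, ∫⁻ z, ‖hilbertOp μ β f z‖ₑ ^ p ∂diskMeasure α ≤
      ENNReal.ofReal C * ∫⁻ z, ‖f z‖ₑ ^ p ∂diskMeasure α) :
    HilbertOpBoundedOn μ β p α := by
  have hp0 : 0 < p := by linarith
  refine ⟨fun f hf => ⟨(hT f hf).hilbertOpDefined hβ, (hT f hf).differentiableOn_hilbertOp hβ, ?_⟩,
    (C ^ (1 / p)).toNNReal, fun f hf => ?_⟩
  · rw [bergmanNorm_lt_top_iff hp0 hα]
    exact (h f hf).trans_lt (ENNReal.mul_lt_top ENNReal.ofReal_lt_top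
      ((bergmanNorm_lt_top_iff hp0 hα f).1 hf.2))
  · rw [bergmanNorm_le_mul_iff hp0 hα]
    convert h f hf using 2
    change ENNReal.ofReal (C ^ (1 / p)) ^ p = _
    rw [ENNReal.ofReal_rpow_of_nonneg (by positivity) hp0.le, ← Real.rpow_mul hC,
      one_div_mul_cancel hp0.ne', Real.rpow_one]

lemma TailBound.hilbertOpBoundedOn {α p C : ℝ} (hα : -1 < α) (hp : 1 < p) (hC : 0 ≤ C)
    {μ : Measure ℝ} (hμ : TailBound (α + 2) C μ) : HilbertOpBoundedOn μ (α + 2) p α := by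
  have hpq := Real.HolderConjugate.conjExponent hp
  set q := p.conjExponent with hq
  have hp0 : 0 < p := hpq.pos
  have hq1 : 1 < q := hpq.symm.lt
  have hq0 : 0 < q := hpq.symm.pos
  have hα1 : 0 < α + 1 := by linarith
  -- Schur's test requires εp < α + 1 on the disc and εq < α + 2 on the radius; here εp = (α +
  -- 1)/(2q) and εq = (α + 1)/(2p).
  set ε := (α + 1) / (2 * p * q) with hε
  have hε0 : 0 < ε := by positivity
  have hεp : ε * p < α + 1 := by
    rw [hε, div_mul_eq_mul_div, div_lt_iff₀ (by positivity)]
    nlinarith [mul_pos hα1 hp0]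
  have hεq : ε * q < α + 2 := by
    rw [hε, div_mul_eq_mul_div, div_lt_iff₀ (by positivity)]
    nlinarith [mul_pos hα1 hq0, mul_pos hp0 hq0]
  have : IsFiniteMeasure (μ.restrict (Ico 0 1)) := ⟨by simpa using hμ.ne_top.lt_top⟩
  obtain ⟨B, hB, hBle⟩ := exists_lintegral_kernel_diskMeasure_le (α := α) (mul_pos hε0 hp0) hεp
  have hT : ∀ f ∈ bergmanSpace p α, TaylorConverges μ f := fun f hf =>
    TaylorConverges.of_tailBound hα hp.le hC hμ hf
  have hδ : 0 < α + 2 - ε * q := by linarith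
  set A := C * 2 ^ (α + 2 + 1) * (1 / (α + 2 - ε * q) + 1 / (ε * q)) with hA
  have hA0 : 0 ≤ A := by positivity
  set D := 9 / Real.pi * C * 2 ^ (α + 2) * 2 ^ |α| with hD
  have hD0 : 0 ≤ D := by have := Real.pi_pos; positivity
  refine hilbertOpBoundedOn_of_lintegral_le (by linarith) hp.le hα hT
    (C := A ^ (p / q) * B * D) (by positivity) fun f hf => ?_
  have hpow : ∀ {x r : ℝ}, 0 < x → 0 ≤ r →
      ENNReal.ofReal (x ^ (-ε)) ^ r = ENNReal.ofReal (x ^ (-(ε * r))) := fun {x r} hx hr => by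
    rw [ENNReal.ofReal_rpow_of_nonneg (by positivity) hr, ← Real.rpow_mul hx.le, neg_mul]
  have hball := ae_mem_ball_diskMeasure α
  have hschur := lintegral_rpow_lintegral_le_of_schur (ν := diskMeasure α)
    (μ := μ.restrict (Ico 0 1)) hpq
    (k := fun (z : ℂ) (t : ℝ) => ENNReal.ofReal (‖1 - t * z‖ ^ (-(α + 2))))
    (by unfold Function.uncurry; fun_prop)
    (a := fun t => ENNReal.ofReal ((1 - t) ^ (-ε))) (by fun_prop) (by
      filter_upwards [ae_restrict_mem measurableSet_Ico] with t ht
      exact ⟨(ENNReal.ofReal_pos.2 (Real.rpow_pos_of_pos (by linarith [ht.2]) _)).ne',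
        ENNReal.ofReal_ne_top⟩)
    (b := fun z => ENNReal.ofReal ((1 - ‖z‖) ^ (-ε))) (by fun_prop)
    (A := ENNReal.ofReal A) (B := ENNReal.ofReal B) (by
      filter_upwards [hball] with z hz
      have hz1 : ‖z‖ < 1 := by simpa using hz
      rw [hpow (by linarith) hq0.le]
      refine le_trans (setLIntegral_mono' measurableSet_Ico fun t ht => ?_)
        (hμ.lintegral_kernel_le (mul_pos hε0 hq0) hεq hC hz1)
      rw [hpow (by linarith [ht.2]) hq0.le]) (by
      filter_upwards [ae_restrict_mem measurableSet_Ico] with t ht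
      rw [hpow (by linarith [ht.2]) hp0.le]
      refine le_trans (lintegral_mono_ae ?_) (hBle t ht)
      filter_upwards [hball] with z hz
      have hz1 : ‖z‖ < 1 := by simpa using hz
      rw [hpow (by linarith) hp0.le])
    (F := fun t : ℝ => ‖f t‖ₑ) (hT f hf).aestronglyMeasurable.enorm
  calc _ ≤ ∫⁻ z, (∫⁻ t in Ico (0 : ℝ) 1, ‖f t‖ₑ *
        ENNReal.ofReal (‖1 - t * z‖ ^ (-(α + 2))) ∂μ) ^ p ∂diskMeasure α := by
        refine lintegral_mono_ae ?_
        filter_upwards [hball] with z hz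
        exact ENNReal.rpow_le_rpow ((hT f hf).enorm_hilbertOp_le (by linarith)
          (by simpa using hz)) hp0.le
    _ ≤ ENNReal.ofReal A ^ (p / q) * ENNReal.ofReal B * (ENNReal.ofReal D *
          ∫⁻ z, ‖f z‖ₑ ^ p ∂diskMeasure α) :=
        hschur.trans (mul_le_mul' le_rfl
          (hμ.lintegral_enorm_rpow_le (by linarith) hp.le hC hf.1))
    _ = _ := by
        rw [ENNReal.ofReal_rpow_of_nonneg hA0 (by positivity), ← mul_assoc,
          ← ENNReal.ofReal_mul (by positivity), ← ENNReal.ofReal_mul (by positivity)]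

/-! ### Sufficiency for p = 1 -/

lemma one_le_one_add_log_one_div {t : ℝ} (ht : t ∈ Ico (0 : ℝ) 1) :
    1 ≤ 1 + Real.log (1 / (1 - t)) := by
  have : 0 ≤ Real.log (1 / (1 - t)) :=
    Real.log_nonneg (by rw [le_div_iff₀ (by linarith [ht.2])]; linarith [ht.1])
  linarith

lemma one_add_log_one_div_mono {x y : ℝ} (hxy : x ≤ y) (hy : y < 1) :
    1 + Real.log (1 / (1 - x)) ≤ 1 + Real.log (1 / (1 - y)) := by
  have h1 : 0 < 1 - y := by linarith
  have h2 : 0 < 1 - x := by linarith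
  have : Real.log (1 / (1 - x)) ≤ Real.log (1 / (1 - y)) :=
    Real.log_le_log (by positivity) (one_div_le_one_div_of_le h1 (by linarith))
  linarith

/-- The distance to 1 at most doubles, so the logarithm changes by at most log 2 < 1. -/
lemma one_add_log_one_div_le_two_mul {x : ℝ} (hx : x ∈ Ioo (0 : ℝ) 1) :
    1 + Real.log (1 / (1 - x)) ≤ 2 * (1 + Real.log (1 / (1 - max (2 * x - 1) 0))) := by
  have hx1 : 0 < 1 - x := by linarith [hx.2]
  set y := max (2 * x - 1) 0 with hy
  have hy1 : y < 1 := max_lt (by linarith) one_pos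
  have hy0 : 0 ≤ y := le_max_right _ _
  have hy2 : 1 - y ≤ 2 * (1 - x) := by linarith [le_max_left (2 * x - 1) 0]
  have hy3 : 0 < 1 - y := by linarith
  have hle : Real.log (1 / (1 - x)) ≤ Real.log (2 * (1 / (1 - y))) := by
    refine Real.log_le_log (by positivity) ?_
    rw [mul_one_div, div_le_div_iff₀ hx1 hy3]
    linarith
  rw [Real.log_mul two_ne_zero (by positivity)] at hle
  have h3 := one_le_one_add_log_one_div ⟨hy0, hy1⟩
  have := Real.log_two_lt_d9
  linarith

/-- Multiplying a logarithmic Carleson measure by the logarithm gives a Carleson measure. -/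
lemma TailBound.withDensity_log {s C : ℝ} (hs : 0 < s) (hC : 0 ≤ C) {μ : Measure ℝ}
    (hfin : μ (Ico 0 1) ≠ ∞)
    (hμ : ∀ t ∈ Ico (0 : ℝ) 1, μ (Ico t 1) * ENNReal.ofReal (1 + Real.log (1 / (1 - t))) ≤
      ENNReal.ofReal (C * (1 - t) ^ s)) :
    TailBound s (C * 2 ^ (s + 2) / s)
      (μ.withDensity fun t => ENNReal.ofReal (1 + Real.log (1 / (1 - t)))) := by
  intro t ht
  set ℓ : ℝ → ℝ≥0∞ := fun t => ENNReal.ofReal (1 + Real.log (1 / (1 - t))) with hℓ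
  have hℓm : Measurable ℓ := by
    have : Measurable fun t : ℝ => Real.log (1 / (1 - t)) :=
      Real.measurable_log.comp (by fun_prop)
    fun_prop
  -- Cut off below t, the density is still increasing, so the tail inequality applies to it.
  set K : ℝ → ℝ≥0∞ := (Ici t).indicator ℓ with hK
  have hmono : MonotoneOn K (Ico 0 1) := by
    intro x hx y hy hxy
    by_cases htx : t ≤ x
    · rw [hK, indicator_of_mem (show x ∈ Ici t from htx),
        indicator_of_mem (show y ∈ Ici t from htx.trans hxy)]
      exact ENNReal.ofReal_le_ofReal (one_add_log_one_div_mono hxy hy.2)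
    · rw [hK, indicator_of_notMem (show x ∉ Ici t from htx)]
      exact zero_le
  have ht1 : 0 < 1 - t := by linarith [ht.2]
  rw [withDensity_apply _ measurableSet_Ico]
  calc ∫⁻ x in Ico t 1, ℓ x ∂μ = ∫⁻ x in Ico 0 1, K x ∂μ := by
        rw [hK, lintegral_indicator measurableSet_Ici, Measure.restrict_restrict measurableSet_Ici]
        congr 2
        ext x
        simp only [mem_inter_iff, mem_Ici, mem_Ico]
        exact ⟨fun h => ⟨h.1, ht.1.trans h.1, h.2⟩, fun h => ⟨h.1, h.2.2⟩⟩
    _ ≤ ∫⁻ x in Ioo 0 1, K x * (ENNReal.ofReal (2 / (1 - x)) *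
          μ (Ico (max (2 * x - 1) 0) 1)) :=
        lintegral_Ico_le_lintegral_tail hfin (hℓm.indicator measurableSet_Ici) hmono
    _ ≤ ∫⁻ x in Ioo 0 1, ENNReal.ofReal (C * 2 ^ (s + 2)) *
          (Ioc 0 (1 - t)).indicator (fun u => ENNReal.ofReal (u ^ (s - 1))) (1 - x) := by
        refine setLIntegral_mono' measurableSet_Ioo fun x hx => ?_
        have hx1 : 0 < 1 - x := by linarith [hx.2]
        by_cases htx : t ≤ x
        · rw [hK, indicator_of_mem (show x ∈ Ici t from htx),
            indicator_of_mem (show 1 - x ∈ Ioc 0 (1 - t) from ⟨hx1, by linarith⟩)]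
          set y := max (2 * x - 1) 0 with hy
          have hy1 : y < 1 := max_lt (by linarith [hx.2]) one_pos
          have hy0 : 0 ≤ y := le_max_right _ _
          have hy2 : 1 - y ≤ 2 * (1 - x) := by linarith [le_max_left (2 * x - 1) 0]
          -- The tail appears at y while the density is taken at x; the doubling bound moves the
          -- logarithm to y, where the hypothesis applies.
          have hℓxy : ℓ x ≤ ENNReal.ofReal 2 * ℓ y := by
            rw [hℓ]
            simp only
            rw [← ENNReal.ofReal_mul two_pos.le]
            exact ENNReal.ofReal_le_ofReal (one_add_log_one_div_le_two_mul hx)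
          calc ℓ x * (ENNReal.ofReal (2 / (1 - x)) * μ (Ico y 1))
              ≤ ENNReal.ofReal 2 * ℓ y * (ENNReal.ofReal (2 / (1 - x)) * μ (Ico y 1)) :=
                mul_le_mul' hℓxy le_rfl
            _ = ENNReal.ofReal 2 * ENNReal.ofReal (2 / (1 - x)) * (μ (Ico y 1) * ℓ y) := by ring
            _ ≤ ENNReal.ofReal 2 * ENNReal.ofReal (2 / (1 - x)) *
                  ENNReal.ofReal (C * (1 - y) ^ s) := mul_le_mul' le_rfl (hμ y ⟨hy0, hy1⟩)
            _ ≤ ENNReal.ofReal 2 * ENNReal.ofReal (2 / (1 - x)) *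
                  ENNReal.ofReal (C * (2 * (1 - x)) ^ s) := by
                refine mul_le_mul' le_rfl (ENNReal.ofReal_le_ofReal ?_)
                have : 0 ≤ 1 - y := by linarith
                gcongr
            _ = _ := by
                rw [← ENNReal.ofReal_mul (by positivity), ← ENNReal.ofReal_mul (by positivity),
                  ← ENNReal.ofReal_mul (by positivity)]
                congr 1
                rw [Real.mul_rpow two_pos.le hx1.le, Real.rpow_sub_one hx1.ne',
                  Real.rpow_add two_pos, Real.rpow_two]
                ring
        · rw [hK, indicator_of_notMem (show x ∉ Ici t from htx), zero_mul]
          exact zero_le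
    _ = ENNReal.ofReal (C * 2 ^ (s + 2)) * ENNReal.ofReal ((1 - t) ^ s / s) := by
        rw [lintegral_const_mul' _ _ ENNReal.ofReal_ne_top,
          setLIntegral_Ioo_zero_one_comp_one_sub, setLIntegral_congr Ioo_ae_eq_Ioc,
          lintegral_indicator measurableSet_Ioc, Measure.restrict_restrict measurableSet_Ioc,
          inter_eq_left.2 (Ioc_subset_Ioc_right (by linarith [ht.1])),
          lintegral_Ioc_rpow_sub_one hs ht1.le]
    _ = _ := by
        rw [← ENNReal.ofReal_mul (by positivity)]
        congr 1
        ring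

/-- By Tonelli the kernel is integrated over the disc first, which costs 1 + log(1/(1 - t)).
Absorbed into the measure, this factor leaves a Carleson measure to which the embedding with p = 1
applies. -/
lemma hilbertOpBoundedOn_one_of_log {α C : ℝ} (hα : -1 < α) (hC : 0 ≤ C) {μ : Measure ℝ}
    (hfin : μ (Ico 0 1) ≠ ∞)
    (hμ : ∀ t ∈ Ico (0 : ℝ) 1, μ (Ico t 1) * ENNReal.ofReal (1 + Real.log (1 / (1 - t))) ≤
      ENNReal.ofReal (C * (1 - t) ^ (α + 2))) :
    HilbertOpBoundedOn μ (α + 2) 1 α := by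
  have hα2 : 0 < α + 2 := by linarith
  have hpi := Real.pi_pos
  have : IsFiniteMeasure (μ.restrict (Ico 0 1)) := ⟨by simpa using hfin.lt_top⟩
  have hμ1 : TailBound (α + 2) C μ := fun t ht => by
    refine le_trans ?_ (hμ t ht)
    refine le_mul_of_one_le_right' ?_
    rw [← ENNReal.ofReal_one]
    exact ENNReal.ofReal_le_ofReal (one_le_one_add_log_one_div ht)
  have hν := TailBound.withDensity_log hα2 hC hfin hμ
  set C' := C * 2 ^ (α + 2 + 2) / (α + 2) with hC'
  have hC'0 : 0 ≤ C' := by positivity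
  obtain ⟨B, hB, hBle⟩ := exists_lintegral_kernel_diskMeasure_le_log hα
  have hT : ∀ f ∈ bergmanSpace 1 α, TaylorConverges μ f := fun f hf =>
    TaylorConverges.of_tailBound hα le_rfl hC hμ1 hf
  set ℓ : ℝ → ℝ≥0∞ := fun t => ENNReal.ofReal (1 + Real.log (1 / (1 - t))) with hℓ
  have hℓm : Measurable ℓ := by
    have : Measurable fun t : ℝ => Real.log (1 / (1 - t)) :=
      Real.measurable_log.comp (by fun_prop)
    fun_prop
  refine hilbertOpBoundedOn_of_lintegral_le hα2 le_rfl hα hT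
    (C := B * (9 / Real.pi * C' * 2 ^ (α + 2) * 2 ^ |α|)) (by positivity) fun f hf => ?_
  have hfm := (hT f hf).aestronglyMeasurable.enorm
  have hemb := hν.lintegral_enorm_rpow_le (by linarith) le_rfl hC'0 hf.1
  rw [setLIntegral_withDensity_eq_setLIntegral_mul_non_measurable _ hℓm _ measurableSet_Ico
    (ae_of_all _ fun _ => ENNReal.ofReal_lt_top)] at hemb
  simp only [ENNReal.rpow_one, Pi.mul_apply] at hemb ⊢
  have hkm : Measurable fun z : ℂ × ℝ => ENNReal.ofReal (‖1 - z.2 * z.1‖ ^ (-(α + 2))) := by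
    fun_prop
  calc ∫⁻ z, ‖hilbertOp μ (α + 2) f z‖ₑ ∂diskMeasure α
      ≤ ∫⁻ z, ∫⁻ t in Ico (0 : ℝ) 1, ‖f t‖ₑ * ENNReal.ofReal (‖1 - t * z‖ ^ (-(α + 2))) ∂μ
          ∂diskMeasure α := by
        refine lintegral_mono_ae ?_
        filter_upwards [ae_mem_ball_diskMeasure α] with z hz
        exact (hT f hf).enorm_hilbertOp_le hα2 (by simpa using hz)
    _ = ∫⁻ t in Ico (0 : ℝ) 1, ∫⁻ z, ‖f t‖ₑ * ENNReal.ofReal (‖1 - t * z‖ ^ (-(α + 2)))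
          ∂diskMeasure α ∂μ := by
        refine lintegral_lintegral_swap ?_
        have h2 : AEMeasurable (fun z : ℂ × ℝ => ‖f z.2‖ₑ)
          ((diskMeasure α).prod (μ.restrict (Ico 0 1))) := hfm.comp_snd
        exact h2.mul hkm.aemeasurable
    _ ≤ ∫⁻ t in Ico (0 : ℝ) 1, ENNReal.ofReal B * (ℓ t * ‖f t‖ₑ) ∂μ := by
        refine setLIntegral_mono' measurableSet_Ico fun t ht => ?_
        rw [lintegral_const_mul _ (by fun_prop)]
        refine (mul_le_mul' le_rfl (hBle t ht)).trans (le_of_eq ?_)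
        ring
    _ ≤ _ := by
        rw [lintegral_const_mul' _ _ ENNReal.ofReal_ne_top, ENNReal.ofReal_mul hB.le, mul_assoc]
        exact mul_le_mul' le_rfl hemb

/-! ### Necessity: lower bounds on a cone -/

lemma abs_arg_le_of_abs_im_le {w : ℂ} {κ : ℝ} (hre : 0 < w.re) (him : |w.im| ≤ κ * w.re) :
    |w.arg| ≤ κ := by
  have hlt : |w.arg| < Real.pi / 2 := Complex.abs_arg_lt_pi_div_two_iff.2 (Or.inl hre)
  have h1 : |w.arg| ≤ Real.tan |w.arg| := Real.le_tan (abs_nonneg _) hlt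
  have h2 : Real.tan |w.arg| = |w.im / w.re| := by
    rw [← Complex.tan_arg]
    rcases le_total 0 w.arg with h | h
    · rw [abs_of_nonneg h, abs_of_nonneg]
      exact Real.tan_nonneg_of_nonneg_of_le_pi_div_two h (le_of_lt (by rwa [abs_of_nonneg h] at hlt))
    · rw [abs_of_nonpos h, Real.tan_neg, abs_of_nonpos]
      exact Real.tan_nonpos_of_nonpos_of_neg_pi_div_two_le h
        (by rw [abs_of_nonpos h] at hlt; linarith)
  rw [h2, abs_div, abs_of_pos hre] at h1
  exact h1.trans ((div_le_iff₀ hre).2 him)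

/-- The real part is |w|^(-s) cos(s arg w), with |s arg w| ≤ 1 and cos x ≥ 1 - x²/2. -/
lemma half_mul_rpow_le_re_cpow {w : ℂ} {s : ℝ} (hs : 0 < s) (hre : 0 < w.re)
    (him : |w.im| ≤ 1 / s * w.re) : 1 / 2 * ‖w‖ ^ (-s) ≤ (w ^ (-(s : ℂ))).re := by
  have hw : w ≠ 0 := fun h => by simp [h] at hre
  have harg := abs_arg_le_of_abs_im_le hre him
  have hcos : 1 / 2 ≤ Real.cos (-(s * w.arg)) := by
    refine le_trans ?_ (Real.one_sub_sq_div_two_le_cos)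
    have : |s * w.arg| ≤ 1 := by
      rw [abs_mul, abs_of_pos hs]
      calc s * |w.arg| ≤ s * (1 / s) := by gcongr
        _ = 1 := mul_one_div_cancel hs.ne'
    have := (sq_le_one_iff_abs_le_one _).2 this
    nlinarith
  rw [Complex.cpow_def_of_ne_zero hw, Complex.exp_re]
  have h1 : (Complex.log w * -(s : ℂ)).re = Real.log ‖w‖ * -s := by
    simp [Complex.log_re]
  have h2 : (Complex.log w * -(s : ℂ)).im = -(s * w.arg) := by
    simp [Complex.log_im, mul_comm]
  rw [h1, h2, Real.rpow_def_of_pos (norm_pos_iff.2 hw), mul_comm]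
  exact mul_le_mul_of_nonneg_left hcos (Real.exp_pos _).le

/-- A truncated cone with vertex at `1`. -/
def cone (κ a : ℝ) : Set ℂ := {z | z.re ∈ Ioc 0 a ∧ |z.im| ≤ κ * (1 - z.re)}

lemma measurableSet_cone (κ a : ℝ) : MeasurableSet (cone κ a) :=
  (Complex.measurable_re measurableSet_Ioc).inter (measurableSet_le
    (continuous_abs.measurable.comp Complex.measurable_im)
    ((Complex.measurable_re.const_sub 1).const_mul κ))

/-- The vertical section at x has length 2κ(1 - x); this supplies the extra power of 1 - x in the
final integral. -/
lemma lintegral_cone {κ a : ℝ} {g : ℝ → ℝ≥0∞} (hg : Measurable g) :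
    ∫⁻ z in cone κ a, g z.re = ∫⁻ x in Ioc 0 a, g x * ENNReal.ofReal (2 * (κ * (1 - x))) := by
  rw [← lintegral_indicator (measurableSet_cone κ a)]
  have hmp := Complex.volume_preserving_equiv_real_prod.symm
  have hm : Measurable ((cone κ a).indicator fun z => g z.re) :=
    (hg.comp Complex.measurable_re).indicator (measurableSet_cone κ a)
  rw [← hmp.lintegral_comp hm, Measure.volume_eq_prod,
    lintegral_prod (fun q : ℝ × ℝ => (cone κ a).indicator (fun z => g z.re)
      (Complex.measurableEquivRealProd.symm q)) (hm.comp hmp.measurable).aemeasurable, ← lintegral_indicator measurableSet_Ioc]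
  refine lintegral_congr fun x => ?_
  have hxy : ∀ y, (cone κ a).indicator (fun z => g z.re) (Complex.measurableEquivRealProd.symm (x, y))
      = (Icc (-(κ * (1 - x))) (κ * (1 - x))).indicator
        (fun _ => (Ioc 0 a).indicator g x) y := by
    intro y
    have hy' : y ∈ Icc (-(κ * (1 - x))) (κ * (1 - x)) ↔ |y| ≤ κ * (1 - x) := abs_le.symm
    by_cases hx : x ∈ Ioc 0 a <;> by_cases hy : |y| ≤ κ * (1 - x)
    · rw [indicator_of_mem (show _ ∈ cone κ a from ⟨hx, hy⟩), indicator_of_mem (hy'.2 hy),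
        indicator_of_mem hx]
      rfl
    · rw [indicator_of_notMem (fun h => hy h.2), indicator_of_notMem fun h => hy (hy'.1 h)]
    · rw [indicator_of_notMem (fun h => hx h.1), indicator_of_mem (hy'.2 hy),
        indicator_of_notMem hx]
    · rw [indicator_of_notMem (fun h => hx h.1), indicator_of_notMem fun h => hy (hy'.1 h)]
  simp only [hxy]
  rw [lintegral_indicator_const measurableSet_Icc, Real.volume_Icc,
    show κ * (1 - x) - -(κ * (1 - x)) = 2 * (κ * (1 - x)) by ring]
  by_cases hx : x ∈ Ioc 0 a
  · rw [indicator_of_mem hx, indicator_of_mem hx]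
  · rw [indicator_of_notMem hx, indicator_of_notMem hx, zero_mul]

section cone
variable {κ a : ℝ} {z : ℂ}

lemma norm_le_of_mem_cone (hκ : κ ≤ 1 / 2) (ha : a < 1) (hz : z ∈ cone κ a) :
    1 / 2 * (1 - z.re) ≤ 1 - ‖z‖ ∧ 1 - ‖z‖ ≤ 1 - z.re := by
  have h1 := Complex.norm_le_abs_re_add_abs_im z
  have h2 := Complex.re_le_norm z
  rw [abs_of_pos hz.1.1] at h1
  have h3 : κ * (1 - z.re) ≤ 1 / 2 * (1 - z.re) :=
    mul_le_mul_of_nonneg_right hκ (by linarith [hz.1.2])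
  exact ⟨by linarith [hz.2], by linarith⟩

lemma rpow_le_rpow_one_sub_sq_of_mem_cone (α : ℝ) (hκ : κ ≤ 1 / 2) (ha : a < 1)
    (hz : z ∈ cone κ a) :
    (4 ^ |α|)⁻¹ * (1 - z.re) ^ α ≤ (1 - ‖z‖ ^ 2) ^ α := by
  obtain ⟨h1, h2⟩ := norm_le_of_mem_cone hκ ha hz
  have hx : 0 < 1 - z.re := by linarith [hz.1.2]
  have hn : 0 < 1 - ‖z‖ := by linarith
  have h3 : (1 - z.re) ^ α ≤ 2 ^ |α| * (1 - ‖z‖) ^ α := by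
    rcases le_total 0 α with h | h
    · rw [abs_of_nonneg h, ← Real.mul_rpow two_pos.le hn.le]
      exact Real.rpow_le_rpow hx.le (by linarith) h
    · refine (Real.rpow_le_rpow_of_nonpos hn h2 h).trans ?_
      exact le_mul_of_one_le_left (by positivity)
        (Real.one_le_rpow one_le_two (abs_nonneg α))
  have h4 := one_sub_rpow_le α (norm_nonneg z) (by linarith)
  rw [inv_mul_le_iff₀ (by positivity), show (4 : ℝ) = 2 * 2 by norm_num,
    Real.mul_rpow two_pos.le two_pos.le, mul_assoc]
  exact h3.trans (by gcongr)

/-- Since t(1 - Re z) ≤ 1 - t Re z, the point 1 - t z stays in the sector for every t in [0, 1). The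
part of the integral over [0, a) can then be discarded by positivity. -/
lemma half_mul_rpow_le_re_one_sub_mul_cpow {s : ℝ} (hs : 1 ≤ s) (ha : a < 1)
    (hz : z ∈ cone (1 / (2 * s)) a) {t : ℝ} (ht : t ∈ Ico (0 : ℝ) 1) :
    1 / 2 * ‖1 - t * z‖ ^ (-s) ≤ ((1 - t * z) ^ (-(s : ℂ))).re := by
  have hx := hz.1
  have hs0 : 0 < s := by linarith
  have h1 : 0 < 1 - t * z.re := by nlinarith [ht.1, ht.2, hx.1, hx.2]
  refine half_mul_rpow_le_re_cpow hs0 (by simpa using h1) ?_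
  have him : (1 - (t : ℂ) * z).im = -(t * z.im) := by simp
  have hre : (1 - (t : ℂ) * z).re = 1 - t * z.re := by simp
  rw [him, hre, abs_neg, abs_mul, abs_of_nonneg ht.1]
  calc t * |z.im| ≤ t * (1 / (2 * s) * (1 - z.re)) := mul_le_mul_of_nonneg_left hz.2 ht.1
    _ = 1 / (2 * s) * (t * (1 - z.re)) := by ring
    _ ≤ 1 / s * (1 - t * z.re) := by
        have : 1 / (2 * s) ≤ 1 / s := one_div_le_one_div_of_le hs0 (by linarith)
        have h2 : t * (1 - z.re) ≤ 1 - t * z.re := by nlinarith [ht.2]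
        have h3 : 0 ≤ t * (1 - z.re) := mul_nonneg ht.1 (by linarith [hx.2])
        gcongr

/-- From t ≥ a ≥ Re z, 1 - t Re z ≤ 1 - (Re z)² ≤ 2(1 - Re z); the imaginary part adds at most half
of 1 - Re z. -/
lemma norm_one_sub_mul_le_of_mem_cone (hκ : κ ≤ 1 / 2) (ha0 : 0 ≤ a) (ha : a < 1)
    (hz : z ∈ cone κ a) {t : ℝ} (ht : t ∈ Ico a 1) : ‖1 - t * z‖ ≤ 3 * (1 - z.re) := by
  have hx := hz.1
  have h1 := Complex.norm_le_abs_re_add_abs_im (1 - t * z)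
  have ht0 : 0 ≤ t := ha0.trans ht.1
  have him : (1 - (t : ℂ) * z).im = -(t * z.im) := by simp
  have hre : (1 - (t : ℂ) * z).re = 1 - t * z.re := by simp
  have h2 : 0 < 1 - t * z.re := by nlinarith [ht.2, hx.1, hx.2]
  rw [him, hre, abs_neg, abs_mul, abs_of_nonneg ht0, abs_of_pos h2] at h1
  have h3 : κ * (1 - z.re) ≤ 1 / 2 * (1 - z.re) :=
    mul_le_mul_of_nonneg_right hκ (by linarith [hx.2])
  have h4 : t * |z.im| ≤ |z.im| := mul_le_of_le_one_left (abs_nonneg _) ht.2.le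
  have h5 := hz.2
  have h6 : 1 - t * z.re ≤ 2 * (1 - z.re) := by nlinarith [ht.1, ht.2, hx.1, hx.2]
  linarith [hx.2]

end cone

/-! ### Necessity: test functions -/

/-- The test functions `(1 - a z) ^ (-m)`. -/
noncomputable def testFun (m : ℕ) (a : ℝ) (z : ℂ) : ℂ := ((1 - a * z) ^ m)⁻¹

section testFun
variable {m : ℕ} {a : ℝ}

/-- The radius 2/(1 + a) exceeds 1 and stays below the pole 1/a, and it makes sense for a = 0 too.
-/
lemma differentiableOn_testFun (ha : a ∈ Ico (0 : ℝ) 1) :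
    DifferentiableOn ℂ (testFun m a) (Metric.ball 0 (2 / (1 + a))) := by
  intro z hz
  have hz' : ‖z‖ < 2 / (1 + a) := by simpa using hz
  rw [lt_div_iff₀ (by linarith [ha.1])] at hz'
  have hne : (1 - a * z : ℂ) ≠ 0 := by
    intro h
    have h1 : (a : ℂ) * z = 1 := by linear_combination -h
    have h2 := congrArg norm h1
    rw [norm_mul, Complex.norm_real, Real.norm_of_nonneg ha.1, norm_one] at h2
    nlinarith [ha.1, ha.2, norm_nonneg z]
  unfold testFun
  refine DifferentiableAt.differentiableWithinAt ?_
  exact DifferentiableAt.inv (by fun_prop) (pow_ne_zero _ hne)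

lemma one_lt_two_div (ha : a ∈ Ico (0 : ℝ) 1) : 1 < 2 / (1 + a) := by
  rw [lt_div_iff₀ (by linarith [ha.1])]
  linarith [ha.2]

lemma enorm_testFun_rpow {p : ℝ} (hp : 0 ≤ p) (z : ℂ) :
    ‖testFun m a z‖ₑ ^ p = ENNReal.ofReal (‖1 - a * z‖ ^ (-(m * p))) := by
  rw [← ofReal_norm, ENNReal.ofReal_rpow_of_nonneg (norm_nonneg _) hp, testFun, norm_inv, norm_pow,
    ← Real.rpow_natCast, ← Real.rpow_neg (norm_nonneg _), ← Real.rpow_mul (norm_nonneg _), neg_mul]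

lemma exists_lintegral_testFun_le {α p : ℝ} (hα : -1 < α) (hp : 0 ≤ p) (hm : α + 2 < m * p) :
    ∃ C : ℝ, 0 < C ∧ ∀ a ∈ Ico (0 : ℝ) 1,
      ∫⁻ z, ‖testFun m a z‖ₑ ^ p ∂diskMeasure α ≤
        ENNReal.ofReal (C * (1 - a) ^ (α + 2 - m * p)) := by
  obtain ⟨C, hC, hle⟩ := exists_lintegral_ball_norm_one_sub_rpow_le hα hm
  refine ⟨2 ^ |α| * C, by positivity, fun a ha => ?_⟩
  refine (lintegral_diskMeasure_le α _).trans ?_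
  rw [mul_assoc, ENNReal.ofReal_mul (by positivity)]
  refine mul_le_mul' le_rfl (le_trans ?_ (hle a ha))
  refine setLIntegral_mono' measurableSet_ball fun z hz => ?_
  have hz1 : 0 < 1 - ‖z‖ := by
    have : ‖z‖ < 1 := by simpa using hz
    linarith
  rw [enorm_testFun_rpow hp, ← ENNReal.ofReal_mul (by positivity), mul_comm]

lemma testFun_mem_bergmanSpace {α p : ℝ} (hα : -1 < α) (hp : 0 < p) (hm : α + 2 < m * p)
    (ha : a ∈ Ico (0 : ℝ) 1) : testFun m a ∈ bergmanSpace p α := by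
  obtain ⟨C, -, hC⟩ := exists_lintegral_testFun_le hα hp.le hm
  refine ⟨(differentiableOn_testFun ha).mono (Metric.ball_subset_ball (one_lt_two_div ha).le), ?_⟩
  rw [bergmanNorm_lt_top_iff hp hα]
  exact (hC a ha).trans_lt ENNReal.ofReal_lt_top

lemma mul_measure_le_enorm_hilbertOp_testFun {μ : Measure ℝ} (hμ : μ (Ico 0 1) ≠ ∞) {s : ℝ}
    (hs : 1 ≤ s) (ha : a ∈ Ico (0 : ℝ) 1) {z : ℂ} (hz : z ∈ cone (1 / (2 * s)) a) :
    ENNReal.ofReal (1 / 2 * (2 ^ m)⁻¹ * 3 ^ (-s) * ((1 - a) ^ m)⁻¹ * (1 - z.re) ^ (-s)) *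
      μ (Ico a 1) ≤ ‖hilbertOp μ s (testFun m a) z‖ₑ := by
  have hs0 : 0 < s := by linarith
  have hκ : 1 / (2 * s) ≤ 1 / 2 := one_div_le_one_div_of_le two_pos (by linarith)
  have hT : TaylorConverges μ (testFun m a) :=
    TaylorConverges.of_differentiableOn hμ (one_lt_two_div ha) (differentiableOn_testFun ha)
  have hfin : IsFiniteMeasure (μ.restrict (Ico 0 1)) := hT.isFiniteMeasure
  have hxr : 0 < 1 - z.re := by linarith [hz.1.2, ha.2]
  have hz1 : ‖z‖ < 1 := by linarith [(norm_le_of_mem_cone hκ ha.2 hz).1]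
  have ha1 : 0 < 1 - a := by linarith [ha.2]
  rw [hT.hilbertOp_eq hs0 hz1]
  set G : ℝ → ℂ := fun t => testFun m a t * (1 - t * z) ^ (-(s : ℂ)) with hG
  have hGint : Integrable G (μ.restrict (Ico 0 1)) := by
    refine (hT.integrable.norm.mul_const ((1 - ‖z‖) ^ (-s))).mono' ?_ ?_
    · refine hT.aestronglyMeasurable.mul ?_
      exact (Measurable.pow_const (by fun_prop) _).aestronglyMeasurable
    · filter_upwards [ae_restrict_mem measurableSet_Ico] with t ht
      rw [hG, norm_mul, ← Complex.ofReal_neg, Complex.norm_cpow_real]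
      refine mul_le_mul_of_nonneg_left ?_ (norm_nonneg _)
      exact Real.rpow_le_rpow_of_nonpos (by linarith)
        ((le_max_right _ _).trans (max_one_sub_le_norm_one_sub_mul ht hz1)) (by linarith)
  set c := 1 / 2 * (2 ^ m)⁻¹ * 3 ^ (-s) * ((1 - a) ^ m)⁻¹ * (1 - z.re) ^ (-s) with hc
  have hc0 : 0 ≤ c := by positivity
  -- The test function is positive on the radius, so the sign of the real part is that of the
  -- kernel. On [a, 1) one has 1 - a t ≤ 2(1 - a) and |1 - t z| ≤ 3(1 - Re z), whence the powers of
  -- 2 and 3 in c.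
  have hre : ∀ t ∈ Ico (0 : ℝ) 1, (Ico a 1).indicator (fun _ => c) t ≤ (G t).re := by
    intro t ht
    have hpos : 0 < 1 - a * t := by nlinarith [ha.1, ha.2, ht.1, ht.2]
    have hf : testFun m a t = (((1 - a * t) ^ m)⁻¹ : ℝ) := by
      rw [testFun]
      push_cast
      rfl
    have hGre : (G t).re = ((1 - a * t) ^ m)⁻¹ * ((1 - t * z) ^ (-(s : ℂ))).re := by
      rw [hG]
      simp only
      rw [hf, Complex.re_ofReal_mul]
    have hlow := half_mul_rpow_le_re_one_sub_mul_cpow hs ha.2 hz ht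
    rw [hGre]
    by_cases hta : t ∈ Ico a 1
    · rw [indicator_of_mem hta]
      have hn0 : 0 < ‖1 - t * z‖ :=
        (lt_max_of_lt_right (by linarith)).trans_le (max_one_sub_le_norm_one_sub_mul ht hz1)
      have hn := norm_one_sub_mul_le_of_mem_cone hκ ha.1 ha.2 hz hta
      have h1 : (3 * (1 - z.re)) ^ (-s) ≤ ‖1 - t * z‖ ^ (-s) :=
        Real.rpow_le_rpow_of_nonpos hn0 hn (by linarith)
      have h2 : ((2 * (1 - a)) ^ m)⁻¹ ≤ ((1 - a * t) ^ m)⁻¹ := by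
        refine inv_anti₀ (by positivity) (pow_le_pow_left₀ hpos.le ?_ m)
        nlinarith [ha.1, ha.2, hta.1]
      calc c = ((2 * (1 - a)) ^ m)⁻¹ * (1 / 2 * (3 * (1 - z.re)) ^ (-s)) := by
            rw [hc, Real.mul_rpow (by norm_num) hxr.le, mul_pow, mul_inv]
            ring
        _ ≤ ((1 - a * t) ^ m)⁻¹ * (1 / 2 * ‖1 - t * z‖ ^ (-s)) := by gcongr
        _ ≤ _ := mul_le_mul_of_nonneg_left hlow (by positivity)
    · rw [indicator_of_notMem hta]
      exact mul_nonneg (by positivity) (le_trans (by positivity) hlow)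
  have hsub : Ico a 1 ⊆ Ico (0 : ℝ) 1 := Ico_subset_Ico_left ha.1
  have hμa : μ (Ico a 1) ≠ ∞ := ((measure_mono hsub).trans_lt hμ.lt_top).ne
  have hle : c * μ.real (Ico a 1) ≤ ‖∫ t in Ico (0 : ℝ) 1, G t ∂μ‖ := by
    calc c * μ.real (Ico a 1) = ∫ t in Ico (0 : ℝ) 1, (Ico a 1).indicator (fun _ => c) t ∂μ := by
          rw [integral_indicator_const _ measurableSet_Ico, smul_eq_mul, mul_comm,
            measureReal_restrict_apply measurableSet_Ico, inter_eq_left.2 hsub]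
      _ ≤ ∫ t in Ico (0 : ℝ) 1, (G t).re ∂μ := by
          refine setIntegral_mono_on ?_ hGint.re measurableSet_Ico hre
          exact (integrable_const c).indicator measurableSet_Ico
      _ = (∫ t in Ico (0 : ℝ) 1, G t ∂μ).re := integral_re hGint
      _ ≤ _ := Complex.re_le_norm _
  rw [← ofReal_norm, ← ENNReal.ofReal_toReal hμa, ← ENNReal.ofReal_mul hc0]
  exact ENNReal.ofReal_le_ofReal hle

end testFun

/-- Well-definedness, even at the zero function, includes integrability of t^0 = 1. -/
lemma HilbertOpBoundedOn.measure_ne_top {μ : Measure ℝ} {β p α : ℝ} (hp : 0 < p) (hα : -1 < α)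
    (h : HilbertOpBoundedOn μ β p α) : μ (Ico 0 1) ≠ ∞ := by
  have h0 : (fun _ => 0 : ℂ → ℂ) ∈ bergmanSpace p α := by
    refine ⟨differentiableOn_const _, ?_⟩
    rw [bergmanNorm_lt_top_iff hp hα]
    simp [ENNReal.zero_rpow_of_pos hp]
  have h1 := (h.1 _ h0).1.1 0
  simp only [pow_zero] at h1
  have h2 := integrable_const_iff.1 h1
  simp only [one_ne_zero, false_or] at h2
  have h3 := h2.measure_univ_lt_top
  rw [Measure.restrict_apply_univ] at h3
  exact h3.ne

/-- Testing the boundedness of `H_{μ,α+2}` on the functions `(1 - a z) ^ (-m)`. -/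
lemma HilbertOpBoundedOn.exists_measure_rpow_mul_lintegral_le {μ : Measure ℝ} {p α : ℝ}
    (hp : 1 ≤ p) (hα : -1 < α) (h : HilbertOpBoundedOn μ (α + 2) p α) :
    ∃ D : ℝ, 0 < D ∧ ∀ a ∈ Ico (0 : ℝ) 1,
      μ (Ico a 1) ^ p * ∫⁻ x in Ioc 0 a, ENNReal.ofReal ((1 - x) ^ (α + 1 - (α + 2) * p)) ≤
        ENNReal.ofReal (D * (1 - a) ^ (α + 2)) := by
  have hμ := h.measure_ne_top (by linarith) hα
  have hp0 : 0 < p := by linarith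
  -- Any integer m > α + 2 serves, since p ≥ 1 gives m p > α + 2; an integer power keeps the test
  -- function free of branches.
  obtain ⟨m, hm⟩ := exists_nat_gt (α + 2)
  have hmp : α + 2 < m * p := hm.trans_le (le_mul_of_one_le_right (by positivity) hp)
  obtain ⟨C₁, hC₁, htest⟩ := exists_lintegral_testFun_le hα hp0.le hmp
  obtain ⟨C₂, hC₂⟩ := h.2
  set s := α + 2 with hs
  have hs1 : 1 ≤ s := by linarith
  have hs0 : 0 < s := by linarith
  set κ := 1 / (2 * s) with hκ
  have hκ0 : 0 < κ := by positivity
  have hκ2 : κ ≤ 1 / 2 := one_div_le_one_div_of_le two_pos (by linarith)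
  set c : ℝ := 1 / 2 * (2 ^ m)⁻¹ * 3 ^ (-s) with hc
  have hc0 : 0 < c := by positivity
  set E := c ^ p * (4 ^ |α|)⁻¹ * (2 * κ) with hE
  have hE0 : 0 < E := by positivity
  -- The summand 1 keeps the constant positive when C₂ = 0.
  refine ⟨((C₂ : ℝ) ^ p * C₁ + 1) / E, by positivity, fun a ha => ?_⟩
  have ha1 : 0 < 1 - a := by linarith [ha.2]
  set M := μ (Ico a 1) with hM
  have hpt : ∀ z ∈ cone κ a, M ^ p * (ENNReal.ofReal (c ^ p * (4 ^ |α|)⁻¹ * (1 - a) ^ (-(m * p))) *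
      ENNReal.ofReal ((1 - z.re) ^ (α - s * p))) ≤
      ‖hilbertOp μ s (testFun m a) z‖ₑ ^ p * ENNReal.ofReal ((1 - ‖z‖ ^ 2) ^ α) := by
    intro z hz
    have hx : 0 < 1 - z.re := by linarith [hz.1.2]
    have h1 := ENNReal.rpow_le_rpow (mul_measure_le_enorm_hilbertOp_testFun (m := m) hμ hs1 ha hz)
      hp0.le
    have h2 := rpow_le_rpow_one_sub_sq_of_mem_cone α hκ2 ha.2 hz
    refine le_trans (le_of_eq ?_) (mul_le_mul' h1 (ENNReal.ofReal_le_ofReal h2))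
    rw [ENNReal.mul_rpow_of_nonneg _ _ hp0.le, mul_comm _ (M ^ p), mul_assoc (M ^ p),
      ENNReal.ofReal_rpow_of_nonneg (by positivity) hp0.le, ← ENNReal.ofReal_mul (by positivity),
      ← ENNReal.ofReal_mul (by positivity)]
    congr 2
    rw [← hc, Real.mul_rpow (x := c * ((1 - a) ^ m)⁻¹) (by positivity) (by positivity),
      Real.mul_rpow (y := ((1 - a) ^ m)⁻¹) hc0.le (by positivity), ← Real.rpow_natCast (1 - a) m,
      ← Real.rpow_neg ha1.le, ← Real.rpow_mul ha1.le, ← Real.rpow_mul hx.le,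
      show α - s * p = -s * p + α by ring, Real.rpow_add hx, neg_mul (m : ℝ)]
    ring
  have hsubset : cone κ a ⊆ Metric.ball 0 1 := fun z hz => by
    have := (norm_le_of_mem_cone hκ2 ha.2 hz).1
    have hx := hz.1.2
    simp only [Metric.mem_ball, dist_zero_right]
    linarith
  have hlow : M ^ p * (ENNReal.ofReal (E * (1 - a) ^ (-(m * p))) *
      ∫⁻ x in Ioc 0 a, ENNReal.ofReal ((1 - x) ^ (α + 1 - s * p))) ≤
      ∫⁻ z, ‖hilbertOp μ s (testFun m a) z‖ₑ ^ p ∂diskMeasure α := by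
    rw [lintegral_diskMeasure]
    refine le_trans ?_ ((setLIntegral_mono' (measurableSet_cone κ a) hpt).trans
      (lintegral_mono_set hsubset))
    have hMtop : M ^ p ≠ ∞ := ENNReal.rpow_ne_top_of_nonneg hp0.le
      ((measure_mono (Ico_subset_Ico_left ha.1)).trans_lt hμ.lt_top).ne
    rw [lintegral_const_mul' _ _ hMtop, lintegral_const_mul' _ _ ENNReal.ofReal_ne_top,
      lintegral_cone (g := fun x => ENNReal.ofReal ((1 - x) ^ (α - s * p))) (by fun_prop),
      ← lintegral_const_mul' _ _ ENNReal.ofReal_ne_top,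
      ← lintegral_const_mul' _ _ ENNReal.ofReal_ne_top]
    refine mul_le_mul' le_rfl (le_of_eq (setLIntegral_congr_fun measurableSet_Ioc fun x hx => ?_))
    have hx1 : 0 < 1 - x := by linarith [hx.2]
    rw [← ENNReal.ofReal_mul (by positivity), ← ENNReal.ofReal_mul (by positivity),
      ← ENNReal.ofReal_mul (by positivity)]
    congr 1
    rw [show α + 1 - s * p = α - s * p + 1 by ring, Real.rpow_add_one hx1.ne', hE]
    ring
  have hup := ((bergmanNorm_le_mul_iff hp0 hα _ _ C₂).1
    (hC₂ _ (testFun_mem_bergmanSpace hα hp0 hmp ha))).trans (mul_le_mul' le_rfl (htest a ha))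
  have hfin := hlow.trans hup
  have hC₂p : (C₂ : ℝ≥0∞) ^ p = ENNReal.ofReal ((C₂ : ℝ) ^ p) := by
    rw [← ENNReal.ofReal_rpow_of_nonneg (NNReal.coe_nonneg C₂) hp0.le, ENNReal.ofReal_coe_nnreal]
  have hcancel : ENNReal.ofReal (E⁻¹ * (1 - a) ^ (m * p)) *
      ENNReal.ofReal (E * (1 - a) ^ (-(m * p))) = 1 := by
    rw [← ENNReal.ofReal_mul (by positivity), ← ENNReal.ofReal_one]
    congr 1
    rw [Real.rpow_neg ha1.le]
    have := Real.rpow_pos_of_pos ha1 (m * p)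
    field_simp
  calc M ^ p * ∫⁻ x in Ioc 0 a, ENNReal.ofReal ((1 - x) ^ (α + 1 - s * p))
      = ENNReal.ofReal (E⁻¹ * (1 - a) ^ (m * p)) * (M ^ p *
          (ENNReal.ofReal (E * (1 - a) ^ (-(m * p))) *
          ∫⁻ x in Ioc 0 a, ENNReal.ofReal ((1 - x) ^ (α + 1 - s * p)))) := by
        rw [mul_left_comm, ← mul_assoc (ENNReal.ofReal (E⁻¹ * _)), hcancel, one_mul]
    _ ≤ ENNReal.ofReal (E⁻¹ * (1 - a) ^ (m * p)) *
          ((C₂ : ℝ≥0∞) ^ p * ENNReal.ofReal (C₁ * (1 - a) ^ (s - m * p))) :=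
        mul_le_mul' le_rfl hfin
    _ = ENNReal.ofReal ((C₂ : ℝ) ^ p * C₁ / E * (1 - a) ^ s) := by
        rw [hC₂p, ← ENNReal.ofReal_mul (by positivity), ← ENNReal.ofReal_mul (by positivity)]
        congr 1
        have := Real.rpow_pos_of_pos ha1 (m * p)
        rw [Real.rpow_sub ha1]
        field_simp
    _ ≤ _ := by
        refine ENNReal.ofReal_le_ofReal ?_
        gcongr
        linarith

lemma HilbertOpBoundedOn.isCarleson {μ : Measure ℝ} {p α : ℝ} (hp : 1 < p) (hα : -1 < α)
    (h : HilbertOpBoundedOn μ (α + 2) p α) : IsCarleson (α + 2) μ := by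
  have hp0 : 0 < p := by linarith
  have hμ := h.measure_ne_top hp0 hα
  obtain ⟨D, hD, hle⟩ := h.exists_measure_rpow_mul_lintegral_le hp.le hα
  set s := α + 2 with hs
  have hs0 : 0 < s := by linarith
  set e := α + 1 - s * p with he
  have he0 : e < 0 := by nlinarith
  -- The first term serves a ≥ 1/2; the second covers a ≤ 1/2, where finiteness of μ suffices.
  set C := (D / 2 ^ e) ^ (1 / p) + (μ (Ico 0 1)).toReal * 2 ^ s with hC
  have hC0 : 0 < C := by positivity
  refine ⟨C, hC0, fun a ha => ?_⟩
  have ha1 : 0 < 1 - a := by linarith [ha.2]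
  have hsub : Ico a 1 ⊆ Ico (0 : ℝ) 1 := Ico_subset_Ico_left ha.1
  have hμa : μ (Ico a 1) ≠ ∞ := ((measure_mono hsub).trans_lt hμ.lt_top).ne
  rcases le_total a (1 / 2) with hhalf | hhalf
  · refine (measure_mono hsub).trans ?_
    rw [← ENNReal.ofReal_toReal hμ]
    refine ENNReal.ofReal_le_ofReal ?_
    have h1 : 1 ≤ 2 ^ s * (1 - a) ^ s := by
      rw [← Real.mul_rpow two_pos.le ha1.le]
      exact Real.one_le_rpow (by linarith) hs0.le
    calc (μ (Ico 0 1)).toReal ≤ (μ (Ico 0 1)).toReal * (2 ^ s * (1 - a) ^ s) :=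
          le_mul_of_one_le_right ENNReal.toReal_nonneg h1
      _ = (μ (Ico 0 1)).toReal * 2 ^ s * (1 - a) ^ s := by ring
      _ ≤ C * (1 - a) ^ s := by
          gcongr
          exact le_add_of_nonneg_left (by positivity)
  -- The piece (2a - 1, a] already carries enough: it has length 1 - a, and there 1 - x ≤ 2(1 - a)
  -- with e < 0.
  · have hI : ENNReal.ofReal ((2 * (1 - a)) ^ e * (1 - a)) ≤
        ∫⁻ x in Ioc 0 a, ENNReal.ofReal ((1 - x) ^ e) := by
      calc ENNReal.ofReal ((2 * (1 - a)) ^ e * (1 - a))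
          = ∫⁻ x in Ioc (2 * a - 1) a, ENNReal.ofReal ((2 * (1 - a)) ^ e) := by
            rw [lintegral_const, Measure.restrict_apply_univ, Real.volume_Ioc,
              ← ENNReal.ofReal_mul (by positivity)]
            congr 2
            ring
        _ ≤ ∫⁻ x in Ioc (2 * a - 1) a, ENNReal.ofReal ((1 - x) ^ e) := by
            refine setLIntegral_mono' measurableSet_Ioc fun x hx => ENNReal.ofReal_le_ofReal ?_
            exact Real.rpow_le_rpow_of_nonpos (by linarith [hx.2]) (by linarith [hx.1]) he0.le
        _ ≤ _ := lintegral_mono_set (Ioc_subset_Ioc_left (by linarith))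
    have h1 := (mul_le_mul' le_rfl hI).trans (hle a ha)
    set M := (μ (Ico a 1)).toReal with hM
    have hM0 : 0 ≤ M := ENNReal.toReal_nonneg
    rw [← ENNReal.ofReal_toReal hμa, ← hM, ENNReal.ofReal_rpow_of_nonneg hM0 hp0.le,
      ← ENNReal.ofReal_mul (by positivity), ENNReal.ofReal_le_ofReal_iff (by positivity)] at h1
    have h2 : M ^ p ≤ D / 2 ^ e * ((1 - a) ^ s) ^ p := by
      rw [Real.mul_rpow two_pos.le ha1.le] at h1
      have h3 : 0 < (1 - a) ^ e := by positivity
      have h4 : (1 - a) ^ s = ((1 - a) ^ s) ^ p * ((1 - a) ^ e * (1 - a)) := by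
        rw [← Real.rpow_add_one ha1.ne', ← Real.rpow_mul ha1.le, ← Real.rpow_add ha1]
        congr 1
        rw [he, hs]
        ring
      have h5 : (0 : ℝ) < 2 ^ e := by positivity
      rw [div_mul_eq_mul_div, le_div_iff₀ h5]
      refine le_of_mul_le_mul_right (a := (1 - a) ^ e * (1 - a)) ?_ (by positivity)
      calc M ^ p * 2 ^ e * ((1 - a) ^ e * (1 - a)) = M ^ p * (2 ^ e * (1 - a) ^ e * (1 - a)) := by
            ring
        _ ≤ D * (1 - a) ^ s := h1
        _ = _ := by rw [mul_assoc, ← h4]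
    have h6 : M ≤ (D / 2 ^ e) ^ (1 / p) * (1 - a) ^ s := by
      have h7 := Real.rpow_le_rpow (by positivity) h2 (show 0 ≤ 1 / p by positivity)
      rwa [Real.mul_rpow (by positivity) (by positivity), ← Real.rpow_mul hM0,
        ← Real.rpow_mul (x := (1 - a) ^ s) (by positivity), mul_one_div_cancel hp0.ne',
        Real.rpow_one, Real.rpow_one] at h7
    rw [← ENNReal.ofReal_toReal hμa]
    refine ENNReal.ofReal_le_ofReal (h6.trans ?_)
    gcongr
    exact le_add_of_nonneg_right (by positivity)

/-- At p = 1 the exponent α + 1 - (α + 2)p is -1, so the integral is the logarithm itself after x ↦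
1 - x. -/
lemma HilbertOpBoundedOn.isLogCarleson {μ : Measure ℝ} {α : ℝ} (hα : -1 < α)
    (h : HilbertOpBoundedOn μ (α + 2) 1 α) : IsLogCarleson 1 (α + 2) μ := by
  obtain ⟨D, hD, hle⟩ := h.exists_measure_rpow_mul_lintegral_le le_rfl hα
  refine ⟨D, hD, fun a ha => le_trans (mul_le_mul' (ENNReal.rpow_one _).ge (le_of_eq ?_)) (hle a ha)⟩
  have ha1 : 0 < 1 - a := by linarith [ha.2]
  rw [Real.rpow_one, show α + 1 - (α + 2) * 1 = -1 by ring, ← lintegral_Ioc_inv ha1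
    (by linarith [ha.1]), ← setLIntegral_congr Ioo_ae_eq_Ioc, ← setLIntegral_congr Ioo_ae_eq_Ioc]
  simp only [Real.rpow_neg_one]
  have hsub1 : Ioo (1 - a) 1 ⊆ Ioo 0 1 := Ioo_subset_Ioo_left ha1.le
  have hsub2 : Ioo 0 a ⊆ Ioo 0 1 := Ioo_subset_Ioo_right ha.2.le
  have := setLIntegral_Ioo_zero_one_comp_one_sub
    ((Ioo (1 - a) 1).indicator fun u => ENNReal.ofReal u⁻¹)
  rw [lintegral_indicator measurableSet_Ioo, Measure.restrict_restrict measurableSet_Ioo,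
    inter_eq_left.2 hsub1] at this
  have hind : ∫⁻ x in Ioo 0 a, ENNReal.ofReal (1 - x)⁻¹ =
      ∫⁻ x in Ioo 0 1, (Ioo 0 a).indicator (fun x => ENNReal.ofReal (1 - x)⁻¹) x := by
    rw [lintegral_indicator measurableSet_Ioo, Measure.restrict_restrict measurableSet_Ioo,
      inter_eq_left.2 hsub2]
  rw [← this, hind]
  refine lintegral_congr fun x => ?_
  simp only [indicator, mem_Ioo]
  congr 1
  exact propext ⟨fun h => ⟨by linarith [h.2], by linarith [h.1]⟩,
    fun h => ⟨by linarith [h.2], by linarith [h.1]⟩⟩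

/-! ### Conclusion -/

/-- The factor log(1/(1 - t)) vanishes at t = 0 and gives no control of μ there. Adding the plain
Carleson bound replaces it by 1 + log(1/(1 - t)). -/
lemma IsLogCarleson.hilbertOpBoundedOn {μ : Measure ℝ} {α : ℝ} (hα : -1 < α)
    (h1 : IsCarleson (α + 2) μ) (h2 : IsLogCarleson 1 (α + 2) μ) :
    HilbertOpBoundedOn μ (α + 2) 1 α := by
  obtain ⟨C₁, hC₁, hle₁⟩ := h1
  obtain ⟨C₂, hC₂, hle₂⟩ := h2
  have hfin : μ (Ico 0 1) ≠ ∞ := TailBound.ne_top (s := α + 2) (C := C₁) hle₁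
  refine hilbertOpBoundedOn_one_of_log hα (C := C₁ + C₂) (by positivity) hfin fun t ht => ?_
  have h3 := one_le_one_add_log_one_div ht
  have ht1 : 0 < 1 - t := by linarith [ht.2]
  have h4 := hle₂ t ht
  rw [Real.rpow_one] at h4
  rw [ENNReal.ofReal_add zero_le_one (by linarith), ENNReal.ofReal_one, mul_add, mul_one, add_mul,
    ENNReal.ofReal_add (by positivity) (by positivity)]
  exact add_le_add (hle₁ t ht) h4

theorem mainTheorem10 (p α : ℝ) (hp : 1 ≤ p) (hα : -1 < α) (μ : Measure ℝ)
    (hμ : StandingCarlesonCondition p α μ) :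
    (1 < p → (HilbertOpBoundedOn μ (α + 2) p α ↔ IsCarleson (α + 2) μ)) ∧
    (p = 1 → (HilbertOpBoundedOn μ (α + 2) 1 α ↔ IsLogCarleson 1 (α + 2) μ)) := by
  refine ⟨fun hp1 => ⟨fun h => h.isCarleson hp1 hα, fun ⟨C, hC, h⟩ =>
    TailBound.hilbertOpBoundedOn hα hp1 hC.le h⟩, fun hp1 => ⟨fun h => h.isLogCarleson hα,
    fun h => h.hilbertOpBoundedOn hα ?_⟩⟩
  subst hp1
  -- At p = 1 the first two alternatives of the standing assumption both have exponent α + 2, and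
  -- the third is impossible.
  rcases hμ with ⟨-, -, h⟩ | ⟨-, -, h⟩ | ⟨h, -⟩
  · simpa using h
  · simpa using h
  · norm_num at h
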